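/- Let $d,m$ be positive integers (state and control dimension) and $0<h<T$. Let $(\Omega,(\mathcal F_t)_{t\ge 0},\mathbb P)$ be a filtered probability space with a one-dimensional Wiener process $W$ adapted to $(\mathcal F_t)$. Let $A\in L^\infty([0,T],\mathbb R^{d\times d})$, $B\in L^\infty([0,T],\mathbb R^{d\times m})$, $\sigma\in L^\infty([0,T],\mathbb R^{d})$ be deterministic. Let $\Phi_A(t,s)$ be the fundamental matrix of $A$ ($\partial_t\Phi_A(t,s)=A(t)\Phi_A(t,s)$, $\Phi_A(s,s)=I$) and $\overline B(t)=\Phi_A(t,t+h)B(t+h)$ for $t\in[0,T-h]$. For a control $U$ let $Y$ denote the solution on $[0,T-h]$ of $$dY(t)=\big(A(t)Y(t)+\overline B(t)U(t)\big)\,dt+\sigma(t)\,dW_t,\qquad Y(0)=0,\tag{1}$$ where solutions are adapted with almost surely continuous paths. Assume that the system is fully actuated: $B(t+h)$ has rank $d$ for every $t\in[0,T-h]$. Then: (a) There is a measurable matrix function $K:[0,T-h]\to\mathbb R^{m\times d}$ such that $\overline B(t)K(t)=I$ for all $t\in[0,T-h]$. It can moreover be chosen essentially bounded if, for some $c>0$,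 $B(t)B(t)^T-cI$ is positive semidefinite for almost every $t\in[h,T]$. (b) Let $K$ be any measurable function with $\overline B(t)K(t)=I$ for all $t\in[0,T-h]$. For every integer $N\ge 1$, equation (1) with the feedback $U_N(t)=-K(t)\,(A(t)+N I)\,Y_N(t)$ has a solution $Y_N$, unique up to indistinguishability. It satisfies $$dY_N(t)=-N\,Y_N(t)\,dt+\sigma(t)\,dW_t,\qquad Y_N(0)=0,$$ and, for every symmetric positive semidefinite $S\in\mathbb R^{d\times d}$ and every $t\in[0,T-h]$, the random variable $Y_N(t)^TSY_N(t)$ is integrable and $$\mathbb E\big[Y_N(t)^T S\,Y_N(t)\big]\le\frac{\|S\|\,\|\sigma\|_\infty^2}{2N},$$ where $\|S\|$ is the operator norm induced by the Euclidean norm and $\|\sigma\|_\infty$ is the essential supremum over $[0,T]$ of the Euclidean norm of $\sigma$. If $K$ is essentially bounded, then $U_N$ is adapted and square integrable on $[0,T-h]\times\Omega$. -/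

import Mathlib

open MeasureTheory ProbabilityTheory Filter Topology
open scoped NNReal ENNReal Matrix Matrix.Norms.L2Operator

noncomputable section

namespace DelayedSDE

/-! Matrices carry the operator norm induced by the Euclidean norms. Time is a real variable;
the Wiener process and the filtration are indexed by `ℝ≥0`. -/

/-- `Ψ` solves `dΨ/dt = A Ψ` on `[0,T]` with `Ψ s = 1`, in the integrated (Carathéodory) sense
appropriate to coefficients `A ∈ L^∞`. -/
structure IsFundamentalSolution {n : ℕ} (A : ℝ → Matrix (Fin n) (Fin n) ℝ) (T s : ℝ)
    (Ψ : ℝ → Matrix (Fin n) (Fin n) ℝ) : Prop where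
  continuousOn : ContinuousOn Ψ (Set.Icc 0 T)
  eq : ∀ t ∈ Set.Icc 0 T, Ψ t = 1 + ∫ r in s..t, A r * Ψ r

open Classical in
/-- The fundamental matrix `Φ_A(t,s)` of `A ∈ L^∞([0,T])`, for `s t ∈ [0,T]`: the value at `t` of
the solution that equals the identity at `s` (it exists, and is unique on `[0,T]`). -/
def fundamentalMatrix {n : ℕ} (A : ℝ → Matrix (Fin n) (Fin n) ℝ) (T t s : ℝ) :
    Matrix (Fin n) (Fin n) ℝ :=
  if hex : ∃ Ψ, IsFundamentalSolution A T s Ψ then hex.choose t else 1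

/-- `B̄(t) = Φ_A(t, t+h) B(t+h)`. -/
def Bbar {n m : ℕ} (A : ℝ → Matrix (Fin n) (Fin n) ℝ) (B : ℝ → Matrix (Fin n) (Fin m) ℝ)
    (T h t : ℝ) : Matrix (Fin n) (Fin m) ℝ :=
  fundamentalMatrix A T t (t + h) * B (t + h)

/-- A deterministic step function, with value `val i` on `(time i, time (i+1)]` for
`i < size`, and zero elsewhere. -/
structure StepFunction (E : Type*) where
  size : ℕ
  time : ℕ → ℝ≥0
  mono : Monotone time
  val : ℕ → E

namespace StepFunction

variable {E Ω : Type*} [NormedAddCommGroup E] [NormedSpace ℝ E]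

/-- The step function as a function of time. -/
def eval (φ : StepFunction E) (s : ℝ) : E :=
  ∑ i ∈ Finset.range φ.size,
    (Set.Ioc (φ.time i : ℝ) (φ.time (i + 1))).indicator (fun _ => φ.val i) s

/-- The elementary stochastic integral `∫₀ᵗ φ dW`. -/
def integral (φ : StepFunction E) (W : ℝ≥0 → Ω → ℝ) (t : ℝ≥0) (ω : Ω) : E :=
  ∑ i ∈ Finset.range φ.size,
    (W (min (φ.time (i + 1)) t) ω - W (min (φ.time i) t) ω) • φ.val i

end StepFunction

/-- `J` is (a version of) the stochastic integral `∫₀ᵗ σ(s) dW_s` of the deterministic function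
`σ`: the limit in `L²(P)` of the elementary integrals of step functions that converge to `σ` in
`L²([0,t])`. By the Itô isometry the limit does not depend on the approximating sequence. -/
def HasItoIntegral {Ω E : Type*} [MeasurableSpace Ω] [NormedAddCommGroup E] [NormedSpace ℝ E]
    (W : ℝ≥0 → Ω → ℝ) (P : Measure Ω) (σ : ℝ → E) (t : ℝ≥0) (J : Ω → E) : Prop :=
  MemLp J 2 P ∧ ∃ φ : ℕ → StepFunction E,
    Tendsto (fun k => eLpNorm (fun s => (φ k).eval s - σ s) 2
      (volume.restrict (Set.Ioc 0 (t : ℝ)))) atTop (𝓝 0) ∧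
    Tendsto (fun k => eLpNorm (fun ω => (φ k).integral W t ω - J ω) 2 P) atTop (𝓝 0)

/-- `Y` is an adapted process with almost surely continuous paths such that
`dY(t) = b(t) dt + σ(t) dW_t` on `[0,S]` and `Y(0) = 0`. The equation is required at each time
almost surely; by continuity this determines `Y` up to indistinguishability. -/
structure SolvesSDE {Ω E : Type*} {mΩ : MeasurableSpace Ω} [NormedAddCommGroup E]
    [NormedSpace ℝ E] (P : Measure Ω) (ℱ : Filtration ℝ≥0 mΩ) (W : ℝ≥0 → Ω → ℝ) (S : ℝ)
    (b : ℝ → Ω → E) (σ : ℝ → E) (Y : ℝ → Ω → E) : Prop where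
  adapted : ∀ t : ℝ≥0, (t : ℝ) ≤ S → StronglyMeasurable[ℱ t] (Y t)
  continuous : ∀ᵐ ω ∂P, ContinuousOn (fun t => Y t ω) (Set.Icc 0 S)
  initial : ∀ᵐ ω ∂P, Y 0 ω = 0
  integrable : ∀ᵐ ω ∂P, IntegrableOn (fun s => b s ω) (Set.Icc 0 S)
  equation : ∀ t : ℝ≥0, (t : ℝ) ≤ S →
    HasItoIntegral W P σ t (fun ω => Y t ω - ∫ s in (0 : ℝ)..t, b s ω)

/-- `Y` solves `dY(t) = (A(t) Y(t) + B̄(t) U(t)) dt + σ(t) dW_t`, `Y(0) = 0`, on `[0,T-h]`. -/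
def SolvesArtstein {Ω : Type*} {mΩ : MeasurableSpace Ω} {n m : ℕ} (P : Measure Ω)
    (ℱ : Filtration ℝ≥0 mΩ) (W : ℝ≥0 → Ω → ℝ) (A : ℝ → Matrix (Fin n) (Fin n) ℝ)
    (B : ℝ → Matrix (Fin n) (Fin m) ℝ) (σ : ℝ → EuclideanSpace ℝ (Fin n)) (T h : ℝ)
    (U : ℝ → Ω → EuclideanSpace ℝ (Fin m)) (Y : ℝ → Ω → EuclideanSpace ℝ (Fin n)) : Prop :=
  SolvesSDE P ℱ W (T - h)
    (fun t ω => Matrix.toEuclideanLin (A t) (Y t ω) +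
      Matrix.toEuclideanLin (Bbar A B T h t) (U t ω)) σ Y

/-- The feedback `U(t) = -K(t) (A(t) + N I) Y(t)`. -/
def feedback {Ω : Type*} {n m : ℕ} (A : ℝ → Matrix (Fin n) (Fin n) ℝ)
    (K : ℝ → Matrix (Fin m) (Fin n) ℝ) (N : ℕ) (Y : ℝ → Ω → EuclideanSpace ℝ (Fin n))
    (t : ℝ) (ω : Ω) : EuclideanSpace ℝ (Fin m) :=
  -Matrix.toEuclideanLin (K t * (A t + (N : ℝ) • (1 : Matrix (Fin n) (Fin n) ℝ))) (Y t ω)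

/-- `U ∈ L²_ℱ([0,S], E)`: adapted and square integrable on `[0,S] × Ω`. -/
structure IsSquareIntegrableAdapted {Ω E : Type*} {mΩ : MeasurableSpace Ω}
    [NormedAddCommGroup E] (P : Measure Ω) (ℱ : Filtration ℝ≥0 mΩ) (S : ℝ)
    (U : ℝ → Ω → E) : Prop where
  adapted : ∀ t : ℝ≥0, (t : ℝ) ≤ S → StronglyMeasurable[ℱ t] (U t)
  memLp : MemLp (fun p : ℝ × Ω => U p.1 p.2) 2 ((volume.restrict (Set.Icc 0 S)).prod P)

end DelayedSDE

end

open DelayedSDE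

namespace DelayedSDE

/-! ### Linear Volterra equations -/

/-! The feedback cancels the drift. Since `B̄ K = I`, for every time and every sample point `A Y +
B̄ U = A Y - (A + N) Y = -N Y`, so the closed loop is the equation `dY = -N Y dt + σ dW`
(`closedLoop_drift`, `solvesArtstein_iff`). Everything about the closed loop is then a statement on
this equation.

For the right inverse take `K(t) = Bᵀ (B Bᵀ)⁻¹ Φ(t+h,t)` with `B` evaluated at `t+h`. The cocycle
identity makes `Φ(t+h,t)` the inverse of `Φ(t,t+h)`, full rank makes the Gram matrix invertible, and
`B Bᵀ ≥ c I` bounds its inverse by `1/c`. The fundamental matrix itself comes from a contraction in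
an exponentially weighted sup norm.

With `M` a continuous version of `∫ σ dW`, the equation reads pathwise `y + c ∫ y = M`. This is
solvable for every continuous `M`, and its solution is the limit of the Riemann–Stieltjes sums
`expSum` for `∫₀ᵗ e^{-c(t-s)} dM(s)`. That one representation, `tendsto_expSum`, serves twice. The
sums use `M` only up to time `t`, so the solution is adapted. The increments of `M` are orthogonal
in `L²` with variance at most `‖σ‖∞²` times the step, so the second moments of the sums are at most
`‖σ‖∞² / (2c)`, and Fatou carries the bound to `Y`.

The version `M` is built from integrals of step functions: the Itô isometry makes them Cauchy in
`L²`, and Doob's maximal inequality with Borel–Cantelli makes the convergence uniform on almost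
every path. For uniqueness, the Itô integral at each time is determined almost surely; a countable
dense set of times and continuity give one null set, and Grönwall finishes. -/

lemma abs_integral_exp_mul_abs_le {l : ℝ} (hl : 0 < l) (s t : ℝ) :
    |∫ r in s..t, Real.exp (l * |r - s|)| ≤ Real.exp (l * |t - s|) / l := by
  rcases le_total s t with h | h
  · have h1 : ∫ r in s..t, Real.exp (l * |r - s|) = ∫ r in s..t, Real.exp (l * (r - s)) := by
      refine intervalIntegral.integral_congr fun r hr => ?_
      rw [Set.uIcc_of_le h] at hr
      simp only [abs_of_nonneg (sub_nonneg.2 hr.1)]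
    have h2 : ∫ r in s..t, Real.exp (l * (r - s))
        = Real.exp (l * (t - s)) / l - Real.exp (l * (s - s)) / l := by
      refine intervalIntegral.integral_eq_sub_of_hasDerivAt
        (f := fun r => Real.exp (l * (r - s)) / l) (fun r _ => ?_)
        (Continuous.intervalIntegrable (by fun_prop) _ _)
      have := ((((hasDerivAt_id r).sub_const s).const_mul l).exp).div_const l
      simp only [id] at this
      exact this.congr_deriv (by rw [mul_one, mul_div_cancel_right₀ _ hl.ne'])
    have h3 : 0 ≤ ∫ r in s..t, Real.exp (l * |r - s|) :=
      intervalIntegral.integral_nonneg h fun r _ => (Real.exp_pos _).le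
    rw [abs_of_nonneg h3, h1, h2, abs_of_nonneg (sub_nonneg.2 h)]
    have : 0 < Real.exp (l * (s - s)) / l := by positivity
    linarith
  · rw [intervalIntegral.integral_symm, abs_neg]
    have h1 : ∫ r in t..s, Real.exp (l * |r - s|) = ∫ r in t..s, Real.exp (l * (s - r)) := by
      refine intervalIntegral.integral_congr fun r hr => ?_
      rw [Set.uIcc_of_le h] at hr
      simp only [abs_of_nonpos (sub_nonpos.2 hr.2), neg_sub]
    have h2 : ∫ r in t..s, Real.exp (l * (s - r))
        = -(Real.exp (l * (s - s)) / l) - -(Real.exp (l * (s - t)) / l) := by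
      refine intervalIntegral.integral_eq_sub_of_hasDerivAt
        (f := fun r => -(Real.exp (l * (s - r)) / l)) (fun r _ => ?_)
        (Continuous.intervalIntegrable (by fun_prop) _ _)
      have := (((((hasDerivAt_id r).const_sub s).const_mul l).exp).div_const l).fun_neg
      simp only [id] at this
      convert this using 1
      field_simp
    have h3 : 0 ≤ ∫ r in t..s, Real.exp (l * |r - s|) :=
      intervalIntegral.integral_nonneg h fun r _ => (Real.exp_pos _).le
    rw [abs_of_nonneg h3, h1, h2, abs_of_nonpos (sub_nonpos.2 h), neg_sub]
    have : 0 < Real.exp (l * (s - s)) / l := by positivity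
    linarith

/-- A bound against an exponentially weighted integral. -/
lemma norm_integral_le_of_norm_le_exp {E : Type*} [NormedAddCommGroup E] [NormedSpace ℝ E]
    {f : ℝ → E} {l M s t : ℝ} (hl : 0 < l)
    (hf : ∀ᵐ r ∂(volume.restrict (Set.uIoc s t)), ‖f r‖ ≤ M * Real.exp (l * |r - s|)) :
    ‖∫ r in s..t, f r‖ ≤ |M| * (Real.exp (l * |t - s|) / l) := by
  have h1 := intervalIntegral.norm_integral_le_abs_of_norm_le hf
    (Continuous.intervalIntegrable (by fun_prop) _ _)
  rw [intervalIntegral.integral_const_mul, abs_mul] at h1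
  exact h1.trans (mul_le_mul_of_nonneg_left (abs_integral_exp_mul_abs_le hl s t) (abs_nonneg _))

/-- **Grönwall's lemma** for a homogeneous integral inequality in both time directions. -/
lemma eq_zero_of_norm_le_abs_integral {E : Type*} [NormedAddCommGroup E] {D : ℝ → E}
    {C T s : ℝ} (hC : 0 ≤ C) (hs : s ∈ Set.Icc 0 T) (hD : ContinuousOn D (Set.Icc 0 T))
    (h : ∀ t ∈ Set.Icc 0 T, ‖D t‖ ≤ C * |∫ r in s..t, ‖D r‖|) :
    ∀ t ∈ Set.Icc 0 T, D t = 0 := by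
  -- Any `l > C` works: the maximum `M` of `e^{-l|t-s|} ‖D t‖` satisfies `M ≤ (C / l) M`, hence
  -- vanishes.
  set l : ℝ := 2 * C + 1 with hl
  have hl0 : 0 < l := by positivity
  have hcont : ContinuousOn (fun t => Real.exp (-(l * |t - s|)) * ‖D t‖) (Set.Icc 0 T) :=
    (Continuous.continuousOn (by fun_prop)).mul hD.norm
  obtain ⟨t₀, ht₀, hmax⟩ := isCompact_Icc.exists_isMaxOn ⟨s, hs⟩ hcont
  set M := Real.exp (-(l * |t₀ - s|)) * ‖D t₀‖ with hM
  have hM0 : 0 ≤ M := by positivity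
  have hle : ∀ r ∈ Set.Icc 0 T, ‖D r‖ ≤ M * Real.exp (l * |r - s|) := fun r hr => by
    have : Real.exp (-(l * |r - s|)) * ‖D r‖ ≤ M := hmax hr
    rw [Real.exp_neg, inv_mul_le_iff₀ (Real.exp_pos _)] at this
    linarith
  have hint := norm_integral_le_of_norm_le_exp (f := fun r => ‖D r‖) (M := M) (s := s) (t := t₀)
    hl0 (by
      filter_upwards [ae_restrict_mem measurableSet_uIoc] with r hr
      rw [norm_norm]
      exact hle r (Set.uIcc_subset_Icc hs ht₀ (Set.uIoc_subset_uIcc hr)))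
  have h1 := h t₀ ht₀
  rw [Real.norm_eq_abs, abs_of_nonneg hM0] at hint
  have h2 : ‖D t₀‖ ≤ C * (M * (Real.exp (l * |t₀ - s|) / l)) :=
    h1.trans (mul_le_mul_of_nonneg_left hint hC)
  have h3 : M ≤ C * M / l := by
    calc M ≤ Real.exp (-(l * |t₀ - s|)) * (C * (M * (Real.exp (l * |t₀ - s|) / l))) :=
          mul_le_mul_of_nonneg_left h2 (Real.exp_pos _).le
      _ = (Real.exp (-(l * |t₀ - s|)) * Real.exp (l * |t₀ - s|)) * (C * M / l) := by ring
      _ = C * M / l := by rw [← Real.exp_add, neg_add_cancel, Real.exp_zero, one_mul]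
  have h4 : M = 0 := by
    rw [le_div_iff₀ hl0] at h3
    nlinarith
  intro t ht
  have := hle t ht
  rw [h4, zero_mul] at this
  exact norm_le_zero_iff.1 this

variable {R : Type*} [NormedRing R] [NormedAlgebra ℝ R]

/-- Uniqueness for linear integral equations with bounded coefficient. -/
lemma eqOn_of_integral_eq {A Ψ Ψ' : ℝ → R} {C T s : ℝ} {c : R}
    (hA : AEStronglyMeasurable A (volume.restrict (Set.Icc 0 T)))
    (hC : ∀ᵐ r ∂(volume.restrict (Set.Icc 0 T)), ‖A r‖ ≤ C) (hs : s ∈ Set.Icc 0 T)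
    (hΨ : ContinuousOn Ψ (Set.Icc 0 T)) (hΨ' : ContinuousOn Ψ' (Set.Icc 0 T))
    (h : ∀ t ∈ Set.Icc 0 T, Ψ t = c + ∫ r in s..t, A r * Ψ r)
    (h' : ∀ t ∈ Set.Icc 0 T, Ψ' t = c + ∫ r in s..t, A r * Ψ' r) :
    Set.EqOn Ψ Ψ' (Set.Icc 0 T) := by
  have hint : ∀ {F : ℝ → R}, ContinuousOn F (Set.Icc 0 T) → ∀ t ∈ Set.Icc 0 T,
      IntervalIntegrable (fun r => A r * F r) volume s t := fun {F} hF t ht => by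
    obtain ⟨b, hb⟩ := isCompact_Icc.exists_bound_of_continuousOn hF
    have h1 : IntegrableOn (fun r => A r * F r) (Set.Icc 0 T) := by
      refine Integrable.of_bound (hA.mul (hF.aestronglyMeasurable measurableSet_Icc)) (C * b) ?_
      filter_upwards [hC, ae_restrict_mem measurableSet_Icc] with r hr hr'
      exact (norm_mul_le _ _).trans (mul_le_mul hr (hb r hr') (norm_nonneg _)
        ((norm_nonneg _).trans hr))
    exact intervalIntegrable_iff.2 (h1.mono_set
      (Set.uIoc_subset_uIcc.trans (Set.uIcc_subset_Icc hs ht)))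
  have key := eq_zero_of_norm_le_abs_integral (D := fun t => Ψ t - Ψ' t) (C := |C|) (abs_nonneg _)
    hs (hΨ.sub hΨ') fun t ht => ?_
  · exact fun t ht => sub_eq_zero.1 (key t ht)
  · have e : Ψ t - Ψ' t = ∫ r in s..t, A r * (Ψ r - Ψ' r) := by
      rw [h t ht, h' t ht, add_sub_add_left_eq_sub,
        ← intervalIntegral.integral_sub (hint hΨ t ht) (hint hΨ' t ht)]
      simp only [mul_sub]
    rw [e]
    have hsub : Set.uIoc s t ⊆ Set.Icc 0 T :=
      Set.uIoc_subset_uIcc.trans (Set.uIcc_subset_Icc hs ht)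
    refine (intervalIntegral.norm_integral_le_abs_of_norm_le (g := fun r => |C| * ‖Ψ r - Ψ' r‖)
      ?_ ?_).trans ?_
    · filter_upwards [ae_restrict_of_ae_restrict_of_subset hsub hC] with r hr
      exact (norm_mul_le _ _).trans (mul_le_mul_of_nonneg_right (hr.trans (le_abs_self _))
        (norm_nonneg _))
    · refine ContinuousOn.intervalIntegrable ?_
      exact (continuousOn_const.mul (hΨ.sub hΨ').norm).mono (Set.uIcc_subset_Icc hs ht)
    · rw [intervalIntegral.integral_const_mul, abs_mul, abs_abs]

variable [CompleteSpace R]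

/-- Existence for linear integral equations with bounded coefficient. -/
lemma exists_continuous_integral_eq {A : ℝ → R} {C T s : ℝ} (c : R)
    (hA : AEStronglyMeasurable A volume) (hC : ∀ᵐ r, ‖A r‖ ≤ C) (hs : s ∈ Set.Icc 0 T) :
    ∃ Ψ : ℝ → R, Continuous Ψ ∧ ∀ t ∈ Set.Icc 0 T, Ψ t = c + ∫ r in s..t, A r * Ψ r := by
  have hT : (0 : ℝ) ≤ T := hs.1.trans hs.2
  set l : ℝ := 2 * |C| + 1 with hl
  have hl0 : 0 < l := by positivity
  set w : ℝ → ℝ := fun r => Real.exp (l * |r - s|) with hw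
  have hwc : Continuous w := by fun_prop
  have hw0 : ∀ r, 0 < w r := fun r => Real.exp_pos _
  -- The unknown is `Z = Ψ / w`, so the ordinary sup distance of `Z` is the weighted distance of
  -- `Ψ`. In it the Picard map has Lipschitz constant `|C| / l ≤ 1/2` on all of `[0,T]`, on both
  -- sides of `s`, and no patching of short intervals is needed.
  set g : C(Set.Icc 0 T, R) → ℝ → R := fun Z r => A r * (w r • Z (Set.projIcc 0 T hT r)) with hg
  have hZc : ∀ Z : C(Set.Icc 0 T, R), Continuous fun r => Z (Set.projIcc 0 T hT r) :=
    fun Z => Z.continuous.comp continuous_projIcc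
  have hint : ∀ Z a b, IntervalIntegrable (g Z) volume a b := fun Z a b => by
    have hb : IntervalIntegrable (fun r => w r • Z (Set.projIcc 0 T hT r)) volume a b :=
      (hwc.smul (hZc Z)).intervalIntegrable _ _
    rw [intervalIntegrable_iff] at hb ⊢
    exact hb.bdd_mul (c := C) hA.restrict (ae_restrict_of_ae hC)
  set F : C(Set.Icc 0 T, R) → C(Set.Icc 0 T, R) := fun Z =>
    ⟨fun t => (w t)⁻¹ • (c + ∫ r in s..t, g Z r), by
      have h1 : Continuous fun t : ℝ => ∫ r in s..t, g Z r :=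
        intervalIntegral.continuous_primitive (hint Z) s
      have h2 : Continuous fun t : ℝ => (w t)⁻¹ := hwc.inv₀ fun t => (hw0 t).ne'
      exact (h2.smul (continuous_const.add h1)).comp continuous_subtype_val⟩ with hF
  have hcontr : ContractingWith (1 / 2) F := by
    refine ⟨by norm_num [← NNReal.coe_lt_coe], LipschitzWith.of_dist_le_mul fun Z Z' => ?_⟩
    rw [ContinuousMap.dist_le (by positivity)]
    intro t
    rw [dist_eq_norm]
    have e : F Z t - F Z' t = (w t)⁻¹ • ∫ r in s..t, (g Z r - g Z' r) := by
      rw [intervalIntegral.integral_sub (hint Z _ _) (hint Z' _ _)]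
      simp only [hF, ContinuousMap.coe_mk, ← smul_sub, add_sub_add_left_eq_sub]
    rw [e, norm_smul, norm_inv, Real.norm_of_nonneg (hw0 _).le, inv_mul_le_iff₀ (hw0 _)]
    have h1 := norm_integral_le_of_norm_le_exp (f := fun r => g Z r - g Z' r)
      (M := |C| * dist Z Z') (s := s) (t := t) hl0 (by
        filter_upwards [ae_restrict_of_ae hC] with r hr
        rw [hg]
        simp only [← mul_sub, ← smul_sub]
        refine (norm_mul_le _ _).trans ?_
        rw [norm_smul, Real.norm_of_nonneg (hw0 _).le, ← dist_eq_norm, mul_comm (w r), ← mul_assoc]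
        refine mul_le_mul_of_nonneg_right ?_ (hw0 r).le
        exact mul_le_mul (hr.trans (le_abs_self _)) (ContinuousMap.dist_apply_le_dist _)
          dist_nonneg (abs_nonneg _))
    refine h1.trans ?_
    rw [abs_of_nonneg (by positivity)]
    have : |C| / l ≤ 1 / 2 := by
      rw [div_le_div_iff₀ hl0 (by norm_num)]; linarith
    calc |C| * dist Z Z' * (Real.exp (l * |↑t - s|) / l)
        = (|C| / l) * (w t * dist Z Z') := by simp only [hw]; ring
      _ ≤ 1 / 2 * (w t * dist Z Z') :=
        mul_le_mul_of_nonneg_right this (mul_nonneg (hw0 _).le dist_nonneg)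
      _ = _ := by push_cast; ring
  set Z := hcontr.fixedPoint F
  have hZ : F Z = Z := hcontr.fixedPoint_isFixedPt
  refine ⟨fun t => w t • Z (Set.projIcc 0 T hT t), hwc.smul (hZc Z), fun t ht => ?_⟩
  have h1 : Z ⟨t, ht⟩ = (w t)⁻¹ • (c + ∫ r in s..t, g Z r) := by
    conv_lhs => rw [← hZ]
    rfl
  simp only [Set.projIcc_of_mem hT ht]
  rw [h1, smul_smul, mul_inv_cancel₀ (hw0 _).ne', one_smul]

end DelayedSDE

namespace DelayedSDE

/-! ### The fundamental matrix -/

/-- An essentially bounded function is bounded almost everywhere by its essential supremum. -/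
lemma ae_norm_le_of_memLp_top {α E : Type*} [MeasurableSpace α] [NormedAddCommGroup E]
    {μ : Measure α} {f : α → E} (hf : MemLp f ∞ μ) :
    ∀ᵐ x ∂μ, ‖f x‖ ≤ (eLpNorm f ∞ μ).toReal := by
  have h := ae_le_eLpNormEssSup (f := f) (μ := μ)
  filter_upwards [h] with x hx
  rw [← toReal_enorm]
  exact ENNReal.toReal_mono hf.2.ne (by rwa [eLpNorm_exponent_top])

section FundamentalMatrix

variable {n : ℕ} {A : ℝ → Matrix (Fin n) (Fin n) ℝ} {T s : ℝ}

lemma exists_isFundamentalSolution (hA : MemLp A ∞ (volume.restrict (Set.Icc 0 T)))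
    (hs : s ∈ Set.Icc 0 T) : ∃ Ψ, IsFundamentalSolution A T s Ψ := by
  -- Extension by zero makes the coefficient measurable and bounded on the whole line.
  set A' := (Set.Icc 0 T).indicator A with hA'
  have h1 : AEStronglyMeasurable A' volume :=
    (aestronglyMeasurable_indicator_iff measurableSet_Icc).2 hA.1
  have h2 : ∀ᵐ r, ‖A' r‖ ≤ (eLpNorm A ∞ (volume.restrict (Set.Icc 0 T))).toReal := by
    filter_upwards [(ae_restrict_iff' measurableSet_Icc).1 (ae_norm_le_of_memLp_top hA)] with r hr
    by_cases h : r ∈ Set.Icc 0 T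
    · rw [hA', Set.indicator_of_mem h]; exact hr h
    · rw [hA', Set.indicator_of_notMem h, norm_zero]; exact ENNReal.toReal_nonneg
  obtain ⟨Ψ, hΨ, hΨe⟩ := exists_continuous_integral_eq (1 : Matrix (Fin n) (Fin n) ℝ) h1 h2 hs
  refine ⟨Ψ, hΨ.continuousOn, fun t ht => ?_⟩
  rw [hΨe t ht]
  congr 1
  refine intervalIntegral.integral_congr fun r hr => ?_
  simp only [hA', Set.indicator_of_mem (Set.uIcc_subset_Icc hs ht hr)]

lemma isFundamentalSolution_fundamentalMatrix
    (hA : MemLp A ∞ (volume.restrict (Set.Icc 0 T))) (hs : s ∈ Set.Icc 0 T) :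
    IsFundamentalSolution A T s (fun t => fundamentalMatrix A T t s) := by
  have hex := exists_isFundamentalSolution hA hs
  have : (fun t => fundamentalMatrix A T t s) = hex.choose := by
    funext t
    rw [fundamentalMatrix, dif_pos hex]
  rw [this]
  exact hex.choose_spec

lemma fundamentalMatrix_self (hA : MemLp A ∞ (volume.restrict (Set.Icc 0 T)))
    (hs : s ∈ Set.Icc 0 T) : fundamentalMatrix A T s s = 1 := by
  have := (isFundamentalSolution_fundamentalMatrix hA hs).eq s hs
  simpa using this

/-- The cocycle identity `Φ(r,t) Φ(t,s) = Φ(r,s)`. -/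
lemma fundamentalMatrix_mul (hA : MemLp A ∞ (volume.restrict (Set.Icc 0 T))) {r t : ℝ}
    (hr : r ∈ Set.Icc 0 T) (ht : t ∈ Set.Icc 0 T) (hs : s ∈ Set.Icc 0 T) :
    fundamentalMatrix A T r t * fundamentalMatrix A T t s = fundamentalMatrix A T r s := by
  have h1 := isFundamentalSolution_fundamentalMatrix hA ht
  have h2 := isFundamentalSolution_fundamentalMatrix hA hs
  have hint : ∀ {F : ℝ → Matrix (Fin n) (Fin n) ℝ}, ContinuousOn F (Set.Icc 0 T) →
      ∀ a ∈ Set.Icc 0 T, ∀ b ∈ Set.Icc 0 T,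
      IntervalIntegrable (fun r => A r * F r) volume a b := fun {F} hF a ha b hb => by
    obtain ⟨c, hc⟩ := isCompact_Icc.exists_bound_of_continuousOn hF
    have h1 : IntegrableOn (fun r => A r * F r) (Set.Icc 0 T) := by
      refine Integrable.of_bound (hA.1.mul (hF.aestronglyMeasurable measurableSet_Icc))
        ((eLpNorm A ∞ (volume.restrict (Set.Icc 0 T))).toReal * c) ?_
      filter_upwards [ae_norm_le_of_memLp_top hA, ae_restrict_mem measurableSet_Icc] with r hr hr'
      exact (norm_mul_le _ _).trans (mul_le_mul hr (hc r hr') (norm_nonneg _)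
        ENNReal.toReal_nonneg)
    exact intervalIntegrable_iff.2 (h1.mono_set
      (Set.uIoc_subset_uIcc.trans (Set.uIcc_subset_Icc ha hb)))
  -- As functions of `r`, both sides solve the same equation and equal `Φ(t,s)` at `r = t`.
  refine eqOn_of_integral_eq (c := fundamentalMatrix A T t s) (s := t) (A := A)
    (Ψ := fun r => fundamentalMatrix A T r t * fundamentalMatrix A T t s)
    (Ψ' := fun r => fundamentalMatrix A T r s) hA.1 (ae_norm_le_of_memLp_top hA) ht
    (h1.continuousOn.mul continuousOn_const) h2.continuousOn (fun r hr => ?_) (fun r hr => ?_) hr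
  · have e := h1.eq r hr
    simp only [← mul_assoc]
    have e' := ((ContinuousLinearMap.mul ℝ (Matrix (Fin n) (Fin n) ℝ)).flip
      (fundamentalMatrix A T t s)).intervalIntegral_comp_comm (hint h1.continuousOn _ ht _ hr)
    simp only [ContinuousLinearMap.flip_apply, ContinuousLinearMap.mul_apply'] at e'
    rw [e', e, add_mul, one_mul]
  · have e := h2.eq r hr
    have e' := h2.eq t ht
    rw [e, e', add_assoc, intervalIntegral.integral_add_adjacent_intervals
      (hint h2.continuousOn _ hs _ ht) (hint h2.continuousOn _ ht _ hr)]

lemma fundamentalMatrix_mul_swap (hA : MemLp A ∞ (volume.restrict (Set.Icc 0 T))) {t : ℝ}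
    (ht : t ∈ Set.Icc 0 T) (hs : s ∈ Set.Icc 0 T) :
    fundamentalMatrix A T t s * fundamentalMatrix A T s t = 1 := by
  rw [fundamentalMatrix_mul hA ht hs ht, fundamentalMatrix_self hA ht]

/-- The transition matrix over a time step of fixed length depends continuously on time. -/
lemma continuousOn_fundamentalMatrix_shift (hA : MemLp A ∞ (volume.restrict (Set.Icc 0 T)))
    {h : ℝ} (hh : 0 ≤ h) (hhT : h ≤ T) :
    ContinuousOn (fun t => fundamentalMatrix A T (t + h) t) (Set.Icc 0 (T - h)) := by
  have h0 : (0 : ℝ) ∈ Set.Icc 0 T := ⟨le_rfl, hh.trans hhT⟩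
  have hsub : Set.Icc 0 (T - h) ⊆ Set.Icc 0 T := Set.Icc_subset_Icc_right (by linarith)
  have hmap : Set.MapsTo (fun t => t + h) (Set.Icc 0 (T - h)) (Set.Icc 0 T) := fun t ht =>
    ⟨by linarith [ht.1], by linarith [ht.2]⟩
  have hX := (isFundamentalSolution_fundamentalMatrix hA h0).continuousOn
  -- Continuity is known only in the first argument of `Φ`. The second one is reached through
  -- `Φ(t+h,t) = Φ(t+h,0) Φ(t,0)⁻¹` and continuity of inversion at units.
  have hXi : ContinuousOn (fun t => Ring.inverse (fundamentalMatrix A T t 0))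
      (Set.Icc 0 (T - h)) := fun t ht => by
    have hu := NormedRing.inverse_continuousAt (R := Matrix (Fin n) (Fin n) ℝ)
      ⟨fundamentalMatrix A T t 0, fundamentalMatrix A T 0 t,
        fundamentalMatrix_mul_swap hA (hsub ht) h0, fundamentalMatrix_mul_swap hA h0 (hsub ht)⟩
    exact ContinuousAt.comp_continuousWithinAt (f := fun t => fundamentalMatrix A T t 0) hu
      ((hX t (hsub ht)).mono hsub)
  refine ((hX.comp (Continuous.continuousOn (by fun_prop)) hmap).mul hXi).congr fun t ht => ?_
  have hu : Ring.inverse (fundamentalMatrix A T t 0) = fundamentalMatrix A T 0 t :=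
    Ring.inverse_unit ⟨fundamentalMatrix A T t 0, fundamentalMatrix A T 0 t,
        fundamentalMatrix_mul_swap hA (hsub ht) h0, fundamentalMatrix_mul_swap hA h0 (hsub ht)⟩
  change _ = fundamentalMatrix A T (t + h) 0 * Ring.inverse (fundamentalMatrix A T t 0)
  rw [hu, fundamentalMatrix_mul hA (hmap ht) h0 (hsub ht)]

end FundamentalMatrix

/-! ### Measurable right inverses -/

/-- Matrix inversion is not continuous at singular matrices, but Cramer's formula reduces it to a
continuous adjugate and the reciprocal of a real function, which is measurable everywhere. -/
lemma aestronglyMeasurable_matrix_inv {α : Type*} [MeasurableSpace α] {μ : Measure α} {n : ℕ}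
    {G : α → Matrix (Fin n) (Fin n) ℝ} (hG : AEStronglyMeasurable G μ) :
    AEStronglyMeasurable (fun x => (G x)⁻¹) μ := by
  simp only [Matrix.inv_def, Ring.inverse_eq_inv']
  have h1 : AEStronglyMeasurable (fun x => (G x).det) μ :=
    Continuous.comp_aestronglyMeasurable (g := fun M : Matrix (Fin n) (Fin n) ℝ => M.det)
      (continuous_id.matrix_det) hG
  have h2 : AEStronglyMeasurable (fun x => (G x).adjugate) μ :=
    Continuous.comp_aestronglyMeasurable (g := fun M : Matrix (Fin n) (Fin n) ℝ => M.adjugate)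
      (continuous_id.matrix_adjugate) hG
  exact h1.aemeasurable.inv.aestronglyMeasurable.smul h2

lemma aestronglyMeasurable_matrix_mul {α : Type*} [MeasurableSpace α] {μ : Measure α}
    {k l m : ℕ} {F : α → Matrix (Fin k) (Fin l) ℝ} {G : α → Matrix (Fin l) (Fin m) ℝ}
    (hF : AEStronglyMeasurable F μ) (hG : AEStronglyMeasurable G μ) :
    AEStronglyMeasurable (fun x => F x * G x) μ :=
  Continuous.comp_aestronglyMeasurable₂
    (g := fun (M : Matrix (Fin k) (Fin l) ℝ) (N : Matrix (Fin l) (Fin m) ℝ) => M * N)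
    (continuous_fst.matrix_mul continuous_snd) hF hG

lemma aestronglyMeasurable_matrix_transpose {α : Type*} [MeasurableSpace α] {μ : Measure α}
    {k l : ℕ} {F : α → Matrix (Fin k) (Fin l) ℝ} (hF : AEStronglyMeasurable F μ) :
    AEStronglyMeasurable (fun x => (F x)ᵀ) μ :=
  Continuous.comp_aestronglyMeasurable (g := fun M : Matrix (Fin k) (Fin l) ℝ => Mᵀ)
    (continuous_id.matrix_transpose) hF

/-- Over the reals the Gram matrix `M Mᵀ` has the rank of `M`, so its `n` rows are independent. -/
lemma isUnit_mul_transpose_of_rank_eq {n m : ℕ} {M : Matrix (Fin n) (Fin m) ℝ}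
    (h : M.rank = n) : IsUnit (M * Mᵀ).det := by
  rw [← Matrix.isUnit_iff_isUnit_det, ← Matrix.linearIndependent_rows_iff_isUnit,
    linearIndependent_iff_card_eq_finrank_span, Set.finrank, ← Matrix.rank_eq_finrank_span_row,
    Matrix.rank_self_mul_transpose, h, Fintype.card_fin]

/-! ### Estimates in the Euclidean operator norm -/

lemma norm_toEuclideanLin_le {k l : ℕ} (M : Matrix (Fin k) (Fin l) ℝ)
    (x : EuclideanSpace ℝ (Fin l)) : ‖Matrix.toEuclideanLin M x‖ ≤ ‖M‖ * ‖x‖ :=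
  Matrix.l2_opNorm_mulVec M x

lemma dotProduct_eq_inner {n : ℕ} (x y : EuclideanSpace ℝ (Fin n)) :
    x.ofLp ⬝ᵥ y.ofLp = inner ℝ x y := by
  rw [EuclideanSpace.inner_eq_star_dotProduct, star_trivial, dotProduct_comm]

lemma dotProduct_mulVec_le {n : ℕ} (S : Matrix (Fin n) (Fin n) ℝ)
    (x : EuclideanSpace ℝ (Fin n)) : x.ofLp ⬝ᵥ (S *ᵥ x.ofLp) ≤ ‖S‖ * ‖x‖ ^ 2 := by
  have : x.ofLp ⬝ᵥ (S *ᵥ x.ofLp) = inner ℝ x (Matrix.toEuclideanLin S x) :=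
    dotProduct_eq_inner x (Matrix.toEuclideanLin S x)
  rw [this]
  calc _ ≤ ‖x‖ * ‖Matrix.toEuclideanLin S x‖ := real_inner_le_norm _ _
    _ ≤ ‖x‖ * (‖S‖ * ‖x‖) :=
      mul_le_mul_of_nonneg_left (norm_toEuclideanLin_le S x) (norm_nonneg _)
    _ = _ := by ring

/-- With `x = G⁻¹ y`, coercivity gives `c ‖x‖² ≤ ⟨x, G x⟩ = ⟨x, y⟩ ≤ ‖x‖ ‖y‖`; divide by `‖x‖`. -/
lemma norm_inv_le_of_posSemidef {n : ℕ} {G : Matrix (Fin n) (Fin n) ℝ} {c : ℝ} (hc : 0 < c)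
    (hG : IsUnit G.det) (h : (G - c • (1 : Matrix (Fin n) (Fin n) ℝ)).PosSemidef) :
    ‖G⁻¹‖ ≤ c⁻¹ := by
  rw [Matrix.l2_opNorm_def]
  refine ContinuousLinearMap.opNorm_le_bound _ (inv_nonneg.2 hc.le) fun y => ?_
  change ‖Matrix.toEuclideanLin G⁻¹ y‖ ≤ _
  set x := Matrix.toEuclideanLin G⁻¹ y with hx
  have hGx : G *ᵥ x.ofLp = y.ofLp := by
    change G *ᵥ (G⁻¹ *ᵥ y.ofLp) = y.ofLp
    rw [Matrix.mulVec_mulVec, Matrix.mul_nonsing_inv _ hG, Matrix.one_mulVec]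
  have h1 := h.dotProduct_mulVec_nonneg x.ofLp
  rw [star_trivial, Matrix.sub_mulVec, Matrix.smul_mulVec, Matrix.one_mulVec, dotProduct_sub,
    dotProduct_smul, hGx, dotProduct_eq_inner, dotProduct_eq_inner, real_inner_self_eq_norm_sq,
    smul_eq_mul] at h1
  have h2 := real_inner_le_norm x y
  rw [inv_mul_eq_div, le_div_iff₀ hc]
  rcases (norm_nonneg x).eq_or_lt with h0 | h0
  · rw [← h0, zero_mul]; exact norm_nonneg _
  · nlinarith

/-- A fully actuated system has a measurable right inverse of the transformed control matrix;
it is essentially bounded if the Gram matrices are uniformly positive. -/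
lemma exists_right_inverse_Bbar {n m : ℕ} {T h : ℝ} (hh : 0 < h) (hhT : h < T)
    {A : ℝ → Matrix (Fin n) (Fin n) ℝ} {B : ℝ → Matrix (Fin n) (Fin m) ℝ}
    (hA : MemLp A ∞ (volume.restrict (Set.Icc 0 T)))
    (hB : MemLp B ∞ (volume.restrict (Set.Icc 0 T)))
    (hrank : ∀ t ∈ Set.Icc h T, (B t).rank = n) :
    ∃ K : ℝ → Matrix (Fin m) (Fin n) ℝ,
      AEStronglyMeasurable K (volume.restrict (Set.Icc 0 (T - h))) ∧
      (∀ t ∈ Set.Icc 0 (T - h), Bbar A B T h t * K t = 1) ∧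
      ((∃ c : ℝ, 0 < c ∧ ∀ᵐ t ∂(volume.restrict (Set.Icc h T)),
          (B t * (B t)ᵀ - c • (1 : Matrix (Fin n) (Fin n) ℝ)).PosSemidef) →
        MemLp K ∞ (volume.restrict (Set.Icc 0 (T - h)))) := by
  -- The shift carries measurability and almost-everywhere bounds of `B` on `[h,T]` to `t ↦ B (t +
  -- h)` on `[0,T-h]`.
  have hmp : MeasurePreserving (fun t : ℝ => t + h) (volume.restrict (Set.Icc 0 (T - h)))
      (volume.restrict (Set.Icc h T)) := by
    have := (measurePreserving_add_right (volume : Measure ℝ) h).restrict_preimage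
      (s := Set.Icc h T) measurableSet_Icc
    simpa using this
  have hsub : Set.Icc h T ⊆ Set.Icc 0 T := Set.Icc_subset_Icc_left hh.le
  have hBh : MemLp B ∞ (volume.restrict (Set.Icc h T)) :=
    hB.mono_measure (Measure.restrict_mono hsub le_rfl)
  have hBm : AEStronglyMeasurable (fun t => B (t + h)) (volume.restrict (Set.Icc 0 (T - h))) :=
    hBh.1.comp_measurePreserving hmp
  have hshift : ∀ t ∈ Set.Icc 0 (T - h), t + h ∈ Set.Icc h T := fun t ht =>
    ⟨by linarith [ht.1], by linarith [ht.2]⟩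
  have hXc := continuousOn_fundamentalMatrix_shift hA hh.le hhT.le
  have hKm : AEStronglyMeasurable
      (fun t => (B (t + h))ᵀ * (B (t + h) * (B (t + h))ᵀ)⁻¹ * fundamentalMatrix A T (t + h) t)
      (volume.restrict (Set.Icc 0 (T - h))) := by
    have hBt := aestronglyMeasurable_matrix_transpose hBm
    exact aestronglyMeasurable_matrix_mul (aestronglyMeasurable_matrix_mul hBt
      (aestronglyMeasurable_matrix_inv (aestronglyMeasurable_matrix_mul hBm hBt)))
      (hXc.aestronglyMeasurable measurableSet_Icc)
  -- The Moore–Penrose right inverse of `B (t + h)`, followed by the inverse `Φ(t+h,t)` of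
  -- `Φ(t,t+h)`.
  refine ⟨fun t => (B (t + h))ᵀ * (B (t + h) * (B (t + h))ᵀ)⁻¹ * fundamentalMatrix A T (t + h) t,
    hKm, fun t ht => ?_, ?_⟩
  · have hu := isUnit_mul_transpose_of_rank_eq (hrank _ (hshift t ht))
    have hs := hsub (hshift t ht)
    have ht' : t ∈ Set.Icc 0 T := ⟨ht.1, by linarith [ht.2]⟩
    calc Bbar A B T h t * ((B (t + h))ᵀ * (B (t + h) * (B (t + h))ᵀ)⁻¹ *
          fundamentalMatrix A T (t + h) t)
        = fundamentalMatrix A T t (t + h) * ((B (t + h) * (B (t + h))ᵀ) *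
          (B (t + h) * (B (t + h))ᵀ)⁻¹) * fundamentalMatrix A T (t + h) t := by
          simp only [Bbar, Matrix.mul_assoc]
      _ = 1 := by
          rw [Matrix.mul_nonsing_inv _ hu, Matrix.mul_one, fundamentalMatrix_mul_swap hA ht' hs]
  · rintro ⟨c, hc, hcB⟩
    obtain ⟨b, hb⟩ := isCompact_Icc.exists_bound_of_continuousOn hXc
    set β := (eLpNorm B ∞ (volume.restrict (Set.Icc h T))).toReal
    refine memLp_top_of_bound hKm (β * c⁻¹ * b) ?_
    filter_upwards [hmp.quasiMeasurePreserving.ae hcB,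
      hmp.quasiMeasurePreserving.ae (ae_norm_le_of_memLp_top hBh),
      ae_restrict_mem measurableSet_Icc] with t h1 h2 ht
    have hu := isUnit_mul_transpose_of_rank_eq (hrank _ (hshift t ht))
    have h3 := norm_inv_le_of_posSemidef hc hu h1
    have h4 : ‖(B (t + h))ᵀ‖ ≤ β := by
      rw [← Matrix.conjTranspose_eq_transpose_of_trivial, Matrix.l2_opNorm_conjTranspose]
      exact h2
    have hβ : 0 ≤ β := ENNReal.toReal_nonneg
    calc _ ≤ ‖(B (t + h))ᵀ‖ * ‖(B (t + h) * (B (t + h))ᵀ)⁻¹‖ *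
          ‖fundamentalMatrix A T (t + h) t‖ :=
          (Matrix.l2_opNorm_mul _ _).trans (mul_le_mul_of_nonneg_right
            (Matrix.l2_opNorm_mul _ _) (norm_nonneg _))
      _ ≤ β * c⁻¹ * b := by
          gcongr
          exact hb t ht

end DelayedSDE

namespace DelayedSDE

/-! ### Square integrable functions with values in an inner product space -/

section NormSq

variable {α E : Type*} [MeasurableSpace α] {μ : Measure α} [NormedAddCommGroup E] {X : α → E}

lemma integrable_norm_sq (hX : MemLp X 2 μ) : Integrable (fun a => ‖X a‖ ^ 2) μ :=
  (memLp_two_iff_integrable_sq_norm hX.1).1 hX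

lemma eLpNorm_two_eq (hX : MemLp X 2 μ) :
    eLpNorm X 2 μ = ENNReal.ofReal (√(∫ a, ‖X a‖ ^ 2 ∂μ)) := by
  rw [hX.eLpNorm_eq_integral_rpow_norm (by norm_num) (by norm_num), Real.sqrt_eq_rpow]
  norm_num

end NormSq

section LTwo

variable {α E : Type*} [MeasurableSpace α] {μ : Measure α} [NormedAddCommGroup E]
  [InnerProductSpace ℝ E] {X Z : α → E}

lemma integrable_inner_of_memLp (hX : MemLp X 2 μ) (hZ : MemLp Z 2 μ) :
    Integrable (fun a => inner ℝ (X a) (Z a)) μ := by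
  refine (L2.integrable_inner (𝕜 := ℝ) (hX.toLp X) (hZ.toLp Z)).congr ?_
  filter_upwards [hX.coeFn_toLp, hZ.coeFn_toLp] with a h1 h2
  rw [h1, h2]

/-- The integrals are inner products of `L²` classes, and the inner product is jointly continuous.
It is applied to `P` and to Lebesgue measure, to pass to the limit on both sides of the isometry. -/
lemma tendsto_integral_inner {Xk Zk : ℕ → α → E} (hXk : ∀ k, MemLp (Xk k) 2 μ)
    (hZk : ∀ k, MemLp (Zk k) 2 μ) (hX : MemLp X 2 μ) (hZ : MemLp Z 2 μ)
    (h1 : Tendsto (fun k => eLpNorm (fun a => Xk k a - X a) 2 μ) atTop (𝓝 0))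
    (h2 : Tendsto (fun k => eLpNorm (fun a => Zk k a - Z a) 2 μ) atTop (𝓝 0)) :
    Tendsto (fun k => ∫ a, inner ℝ (Xk k a) (Zk k a) ∂μ) atTop
      (𝓝 (∫ a, inner ℝ (X a) (Z a) ∂μ)) := by
  have e : ∀ {F G : α → E} (hF : MemLp F 2 μ) (hG : MemLp G 2 μ),
      ∫ a, inner ℝ (F a) (G a) ∂μ = inner ℝ (hF.toLp F) (hG.toLp G) := fun hF hG => by
    rw [L2.inner_def]
    refine integral_congr_ae ?_
    filter_upwards [hF.coeFn_toLp, hG.coeFn_toLp] with a h1 h2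
    rw [h1, h2]
  simp only [fun k => e (hXk k) (hZk k), e hX hZ]
  exact ((Lp.tendsto_Lp_iff_tendsto_eLpNorm'' _ hXk _ hX).2 h1).inner
    ((Lp.tendsto_Lp_iff_tendsto_eLpNorm'' _ hZk _ hZ).2 h2)

lemma integral_norm_sub_sq (hX : MemLp X 2 μ) (hZ : MemLp Z 2 μ) :
    ∫ a, ‖X a - Z a‖ ^ 2 ∂μ = ∫ a, inner ℝ (X a) (X a) ∂μ - 2 * ∫ a, inner ℝ (X a) (Z a) ∂μ
      + ∫ a, inner ℝ (Z a) (Z a) ∂μ := by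
  have h1 := integrable_inner_of_memLp hX hX
  have h2 := (integrable_inner_of_memLp hX hZ).const_mul 2
  have h3 := integrable_inner_of_memLp hZ hZ
  rw [← integral_const_mul, ← integral_sub h1 h2, ← integral_add (h1.sub' h2) h3]
  refine integral_congr_ae (Eventually.of_forall fun a => ?_)
  simp only [norm_sub_sq_real, real_inner_self_eq_norm_sq]

end LTwo

/-! ### The Itô isometry -/

section Isometry

variable {Ω : Type*} [mΩ : MeasurableSpace Ω] {P : Measure Ω} {W : ℝ≥0 → Ω → ℝ}

lemma memLp_two_brownian (hW : IsPreBrownianReal W P) (t : ℝ≥0) : MemLp (W t) 2 P :=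
  (hW.isGaussianProcess.hasGaussianLaw_eval t).memLp_two

lemma integral_brownian_mul [IsProbabilityMeasure P] (hW : IsPreBrownianReal W P) (s t : ℝ≥0) :
    ∫ ω, W s ω * W t ω ∂P = min s t := by
  have h := hW.covariance_eval s t
  rw [covariance_eq_sub (memLp_two_brownian hW s) (memLp_two_brownian hW t),
    hW.integral_eval, zero_mul, sub_zero] at h
  simpa using h

/-- Bilinearity and the covariance `min s t` give the length of the overlap. In this form
overlapping intervals from two different partitions need no common refinement. -/
lemma integral_brownian_increment_mul [IsProbabilityMeasure P] (hW : IsPreBrownianReal W P)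
    {a b c d : ℝ≥0} (hab : a ≤ b) (hcd : c ≤ d) :
    ∫ ω, (W b ω - W a ω) * (W d ω - W c ω) ∂P
      = volume.real (Set.Ioc (a : ℝ) b ∩ Set.Ioc (c : ℝ) d) := by
  have hi : ∀ s t, Integrable (fun ω => W s ω * W t ω) P := fun s t =>
    (memLp_two_brownian hW s).integrable_mul (memLp_two_brownian hW t)
  have e : ∀ ω, (W b ω - W a ω) * (W d ω - W c ω)
      = (W b ω * W d ω - W b ω * W c ω) - (W a ω * W d ω - W a ω * W c ω) := fun ω => by ring
  simp only [e]
  rw [integral_sub ((hi _ _).sub' (hi _ _)) ((hi _ _).sub' (hi _ _)), integral_sub (hi _ _) (hi _ _),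
    integral_sub (hi _ _) (hi _ _)]
  simp only [integral_brownian_mul hW, Set.Ioc_inter_Ioc, Real.volume_real_Ioc, NNReal.coe_min]
  have h1 : (a : ℝ) ≤ b := hab
  have h2 : (c : ℝ) ≤ d := hcd
  grind

variable {E : Type*} [NormedAddCommGroup E]

namespace StepFunction

lemma memLp_integral [NormedSpace ℝ E] (hW : IsPreBrownianReal W P) (φ : StepFunction E)
    (t : ℝ≥0) :
    MemLp (φ.integral W t) 2 P := by
  unfold StepFunction.integral
  refine memLp_finsetSum _ fun i _ => ?_
  have h := (memLp_two_brownian hW (min (φ.time (i + 1)) t)).sub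
    (memLp_two_brownian hW (min (φ.time i) t))
  exact (ContinuousLinearMap.toSpanSingleton ℝ (φ.val i)).comp_memLp' h

lemma memLp_eval [NormedSpace ℝ E] (φ : StepFunction E) {μ : Measure ℝ} [IsFiniteMeasure μ] (p : ℝ≥0∞) :
    MemLp φ.eval p μ := by
  unfold StepFunction.eval
  exact memLp_finsetSum _ fun i _ => (memLp_const _).indicator measurableSet_Ioc

variable [InnerProductSpace ℝ E]

/-- The **Itô isometry** for step functions, in polarized form. -/
lemma integral_inner_integral [IsProbabilityMeasure P] (hW : IsPreBrownianReal W P)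
    (φ ψ : StepFunction E) (s t : ℝ≥0) :
    ∫ ω, inner ℝ (φ.integral W s ω) (ψ.integral W t ω) ∂P
      = ∫ r in Set.Ioc 0 ((min s t : ℝ≥0) : ℝ), inner ℝ (φ.eval r) (ψ.eval r) := by
  have hi'' : ∀ i j : ℕ, Integrable (fun ω =>
      (W (min (ψ.time (j + 1)) t) ω - W (min (ψ.time j) t) ω) *
      (W (min (φ.time (i + 1)) s) ω - W (min (φ.time i) s) ω)) P :=
    fun i j => ((memLp_two_brownian hW _).sub (memLp_two_brownian hW _)).integrable_mul
      ((memLp_two_brownian hW _).sub (memLp_two_brownian hW _))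
  simp only [StepFunction.integral, StepFunction.eval, sum_inner, inner_sum, real_inner_smul_left,
    real_inner_smul_right, ← mul_assoc]
  have e : ∀ i j : ℕ, ∀ r : ℝ, inner ℝ
      ((Set.Ioc (φ.time i : ℝ) (φ.time (i + 1))).indicator (fun _ => φ.val i) r)
      ((Set.Ioc (ψ.time j : ℝ) (ψ.time (j + 1))).indicator (fun _ => ψ.val j) r)
      = (Set.Ioc (φ.time i : ℝ) (φ.time (i + 1)) ∩
          Set.Ioc (ψ.time j : ℝ) (ψ.time (j + 1))).indicator
          (fun _ => inner ℝ (φ.val i) (ψ.val j)) r := fun i j r => by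
    by_cases h1 : r ∈ Set.Ioc (φ.time i : ℝ) (φ.time (i + 1)) <;>
    by_cases h2 : r ∈ Set.Ioc (ψ.time j : ℝ) (ψ.time (j + 1)) <;>
    simp only [Set.indicator, Set.mem_inter_iff, h1, h2, and_self, and_false, false_and,
      if_true, if_false, inner_zero_left, inner_zero_right]
  simp only [e]
  have hm : ∀ i j : ℕ, MeasurableSet (Set.Ioc (φ.time i : ℝ) (φ.time (i + 1)) ∩
      Set.Ioc (ψ.time j : ℝ) (ψ.time (j + 1))) := fun i j =>
    measurableSet_Ioc.inter measurableSet_Ioc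
  have hi' : ∀ i j : ℕ, Integrable ((Set.Ioc (φ.time i : ℝ) (φ.time (i + 1)) ∩
          Set.Ioc (ψ.time j : ℝ) (ψ.time (j + 1))).indicator
          (fun _ => (inner ℝ (φ.val i) (ψ.val j) : ℝ)))
          (volume.restrict (Set.Ioc 0 ((min s t : ℝ≥0) : ℝ))) := fun i j =>
    (integrable_const _).indicator (hm i j)
  rw [integral_finsetSum _ fun j _ => integrable_finsetSum _ fun i _ => (hi'' i j).mul_const _,
    integral_finsetSum _ fun j _ => integrable_finsetSum _ fun i _ => hi' i j]
  refine Finset.sum_congr rfl fun j _ => ?_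
  rw [integral_finsetSum _ fun i _ => (hi'' i j).mul_const _,
    integral_finsetSum _ fun i _ => hi' i j]
  refine Finset.sum_congr rfl fun i _ => ?_
  rw [integral_mul_const, integral_brownian_increment_mul hW
    (min_le_min_right _ (ψ.mono j.le_succ)) (min_le_min_right _ (φ.mono i.le_succ)),
    setIntegral_indicator (hm i j), setIntegral_const, smul_eq_mul]
  -- Truncating the partition intervals at `t` and `s` and then intersecting them is the same as
  -- intersecting them with `(0, min s t]`, because partition times are nonnegative.
  congr 2
  have h1 := (φ.time i).coe_nonneg
  have h2 := (ψ.time j).coe_nonneg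
  ext x
  simp only [Set.mem_inter_iff, Set.mem_Ioc, NNReal.coe_min]
  clear hi' hi'' hm e
  grind

/-- The **Itô isometry** for the difference of two step functions. -/
lemma eLpNorm_integral_sub [IsProbabilityMeasure P] (hW : IsPreBrownianReal W P)
    (φ ψ : StepFunction E) (t : ℝ≥0) :
    eLpNorm (fun ω => φ.integral W t ω - ψ.integral W t ω) 2 P
      = eLpNorm (fun r => φ.eval r - ψ.eval r) 2 (volume.restrict (Set.Ioc 0 (t : ℝ))) := by
  have h1 := φ.memLp_integral hW t
  have h2 := ψ.memLp_integral hW t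
  have h3 := φ.memLp_eval (μ := volume.restrict (Set.Ioc 0 (t : ℝ))) 2
  have h4 := ψ.memLp_eval (μ := volume.restrict (Set.Ioc 0 (t : ℝ))) 2
  have e1 := eLpNorm_two_eq (h1.sub h2)
  have e2 := eLpNorm_two_eq (h3.sub h4)
  simp only [Pi.sub_apply] at e1 e2
  rw [integral_norm_sub_sq h1 h2, integral_inner_integral hW, integral_inner_integral hW,
    integral_inner_integral hW, min_self, ← integral_norm_sub_sq h3 h4] at e1
  exact e1.trans e2.symm

end StepFunction

/-- The covariance of two Itô integrals of the same deterministic function. -/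
lemma HasItoIntegral.integral_inner [InnerProductSpace ℝ E] [IsProbabilityMeasure P]
    (hW : IsPreBrownianReal W P) {σ : ℝ → E} {s t : ℝ≥0} {J J' : Ω → E}
    (hσ : MemLp σ 2 (volume.restrict (Set.Ioc 0 (max s t : ℝ))))
    (hJ : HasItoIntegral W P σ s J) (hJ' : HasItoIntegral W P σ t J') :
    ∫ ω, inner ℝ (J ω) (J' ω) ∂P
      = ∫ r in Set.Ioc 0 ((min s t : ℝ≥0) : ℝ), ‖σ r‖ ^ 2 := by
  obtain ⟨hJ2, φ, hφ, hφJ⟩ := hJ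
  obtain ⟨hJ2', ψ, hψ, hψJ⟩ := hJ'
  have hl := tendsto_integral_inner (fun k => (φ k).memLp_integral hW s)
    (fun k => (ψ k).memLp_integral hW t) hJ2 hJ2' hφJ hψJ
  simp only [StepFunction.integral_inner_integral hW] at hl
  have hs : volume.restrict (Set.Ioc 0 ((min s t : ℝ≥0) : ℝ)) ≤
      volume.restrict (Set.Ioc 0 (s : ℝ)) :=
    Measure.restrict_mono (Set.Ioc_subset_Ioc_right (by simp)) le_rfl
  have ht : volume.restrict (Set.Ioc 0 ((min s t : ℝ≥0) : ℝ)) ≤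
      volume.restrict (Set.Ioc 0 (t : ℝ)) :=
    Measure.restrict_mono (Set.Ioc_subset_Ioc_right (by simp)) le_rfl
  have hσ' : MemLp σ 2 (volume.restrict (Set.Ioc 0 ((min s t : ℝ≥0) : ℝ))) :=
    hσ.mono_measure (Measure.restrict_mono (Set.Ioc_subset_Ioc_right (by simp)) le_rfl)
  have hr := tendsto_integral_inner
    (μ := volume.restrict (Set.Ioc 0 ((min s t : ℝ≥0) : ℝ)))
    (fun k => (φ k).memLp_eval 2) (fun k => (ψ k).memLp_eval 2) hσ' hσ'
    (tendsto_of_tendsto_of_tendsto_of_le_of_le tendsto_const_nhds hφ (fun _ => zero_le)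
      fun k => eLpNorm_mono_measure _ hs)
    (tendsto_of_tendsto_of_tendsto_of_le_of_le tendsto_const_nhds hψ (fun _ => zero_le)
      fun k => eLpNorm_mono_measure _ ht)
  rw [tendsto_nhds_unique hl hr]
  simp only [real_inner_self_eq_norm_sq]

/-- The Itô integral is almost surely unique. -/
lemma HasItoIntegral.ae_eq [InnerProductSpace ℝ E] [IsProbabilityMeasure P]
    (hW : IsPreBrownianReal W P) {σ : ℝ → E} {t : ℝ≥0} {J J' : Ω → E}
    (hσ : MemLp σ 2 (volume.restrict (Set.Ioc 0 (t : ℝ))))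
    (hJ : HasItoIntegral W P σ t J) (hJ' : HasItoIntegral W P σ t J') : J =ᵐ[P] J' := by
  have hσ' : MemLp σ 2 (volume.restrict (Set.Ioc 0 (max t t : ℝ))) := by rwa [max_self]
  have h := integral_norm_sub_sq hJ.1 hJ'.1
  rw [hJ.integral_inner hW hσ' hJ, hJ.integral_inner hW hσ' hJ', hJ'.integral_inner hW hσ' hJ'] at h
  -- The three covariances all equal `∫ ‖σ‖²`, so the expanded square is `a - 2 a + a`.
  have h0 : ∫ ω, ‖J ω - J' ω‖ ^ 2 ∂P = 0 := by rw [h]; ring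
  have hi : Integrable (fun ω => ‖J ω - J' ω‖ ^ 2) P := integrable_norm_sq (hJ.1.sub hJ'.1)
  rw [integral_eq_zero_iff_of_nonneg (fun ω => sq_nonneg _)
    hi] at h0
  filter_upwards [h0] with ω hω
  simpa [sub_eq_zero] using hω

end Isometry

end DelayedSDE

namespace DelayedSDE

/-! ### Martingales and the maximal inequality -/

section Maximal

set_option linter.unusedSectionVars false

variable {Ω E : Type*} [mΩ : MeasurableSpace Ω] {P : Measure Ω} [IsProbabilityMeasure P]
  [NormedAddCommGroup E] [NormedSpace ℝ E] [CompleteSpace E]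

/-- Brownian motion is a martingale with respect to its natural filtration. -/
lemma martingale_brownian {W : ℝ≥0 → Ω → ℝ} (hW : IsPreBrownianReal W P)
    (hWm : ∀ t, StronglyMeasurable (W t)) : Martingale W (Filtration.natural W hWm) P := by
  have had := Filtration.stronglyAdapted_natural hWm
  refine ⟨had, fun s t hst => ?_⟩
  -- The increment is the value at `t - s` of the process restarted at `s`, which is independent of
  -- the path up to `s`.
  have hind : Indep (MeasurableSpace.comap (fun ω => W t ω - W s ω) inferInstance)
      (Filtration.natural W hWm s) P := by
    rw [Filtration.natural_eq_comap]
    have h := (hW.indepFun_shift s).comp (φ := fun x : ℝ≥0 → ℝ => x (t - s)) (ψ := id)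
      (measurable_pi_apply (X := fun _ : ℝ≥0 => ℝ) (t - s)) measurable_id
    rw [IndepFun_iff_Indep] at h
    convert h using 2
    · funext ω
      simp [add_tsub_cancel_of_le hst]
    · rfl
  have hsm : StronglyMeasurable (fun ω => W t ω - W s ω) := (hWm t).sub (hWm s)
  have h0 := condExp_indep_eq hsm.measurable.comap_le ((Filtration.natural W hWm).le s)
    (comap_measurable _).stronglyMeasurable hind
  have hint : ∀ r, Integrable (W r) P := hW.integrable_eval
  have h1 : P[fun ω => W t ω - W s ω | Filtration.natural W hWm s] =ᵐ[P]
      P[W t | Filtration.natural W hWm s] - P[W s | Filtration.natural W hWm s] :=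
    condExp_sub (hint t) (hint s) _
  rw [condExp_of_stronglyMeasurable ((Filtration.natural W hWm).le s) (had s) (hint s)] at h1
  filter_upwards [h0, h1] with ω h0 h1
  rw [h0, integral_sub (hint t) (hint s), hW.integral_eval, hW.integral_eval] at h1
  have h2 : (0 : ℝ) = P[W t | Filtration.natural W hWm s] ω - W s ω := by simpa using h1
  linarith

/-- This is `W` stopped at the deterministic time `b`; elementary integrals are combinations of such
processes. -/
lemma martingale_min {W : ℝ≥0 → Ω → ℝ} {𝒢 : Filtration ℝ≥0 mΩ} (hW : Martingale W 𝒢 P)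
    (b : ℝ≥0) : Martingale (fun t => W (min b t)) 𝒢 P := by
  refine ⟨fun t => (hW.1 _).mono (𝒢.mono (min_le_right _ _)), fun s t hst => ?_⟩
  change P[W (min b t) | 𝒢 s] =ᵐ[P] W (min b s)
  rcases le_total b s with h | h
  · rw [min_eq_left h, min_eq_left (h.trans hst), condExp_of_stronglyMeasurable (𝒢.le s)
      ((hW.1 b).mono (𝒢.mono h)) (hW.integrable b)]
  · rw [min_eq_right h]
    exact hW.2 s _ (le_min h hst)

lemma martingale_smul_const {X : ℝ≥0 → Ω → ℝ} {𝒢 : Filtration ℝ≥0 mΩ} (hX : Martingale X 𝒢 P)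
    (v : E) : Martingale (fun t ω => X t ω • v) 𝒢 P := by
  refine ⟨fun t => (hX.1 t).smul_const v, fun s t hst => ?_⟩
  have h := ContinuousLinearMap.comp_condExp_comm (m := 𝒢 s) (hX.integrable t)
    (ContinuousLinearMap.toSpanSingleton ℝ v)
  filter_upwards [h, hX.2 s t hst] with ω h1 h2
  simp only [Function.comp_def, ContinuousLinearMap.toSpanSingleton_apply] at h1
  rw [← h1, h2]

lemma StepFunction.martingale_integral {W : ℝ≥0 → Ω → ℝ} {𝒢 : Filtration ℝ≥0 mΩ}
    (hW : Martingale W 𝒢 P) (φ : StepFunction E) :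
    Martingale (fun t ω => φ.integral W t ω) 𝒢 P := by
  have key : ∀ s : Finset ℕ, Martingale (∑ i ∈ s, fun t ω =>
      (W (min (φ.time (i + 1)) t) ω - W (min (φ.time i) t) ω) • φ.val i) 𝒢 P := fun s => by
    induction s using Finset.cons_induction with
    | empty => simpa using martingale_zero E 𝒢 P
    | cons i s hi ih =>
      rw [Finset.sum_cons]
      exact (martingale_smul_const ((martingale_min hW _).sub (martingale_min hW _)) _).add ih
  convert key (Finset.range φ.size) using 1
  funext t ω
  simp only [StepFunction.integral, Finset.sum_apply]

lemma submartingale_norm {ι : Type*} [Preorder ι] {X : ι → Ω → E} {𝒢 : Filtration ι mΩ}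
    (hX : Martingale X 𝒢 P) : Submartingale (fun t ω => ‖X t ω‖) 𝒢 P := by
  refine ⟨fun t => (hX.1 t).norm, fun s t hst => ?_, fun t => (hX.integrable t).norm⟩
  filter_upwards [hX.2 s t hst, norm_condExp_le (m := 𝒢 s) (μ := P) (X t)] with ω h1 h2
  rwa [h1] at h2

/-- **Doob's maximal inequality** along a monotone finite sequence of times. -/
lemma measure_exists_le_norm_le {D : ℝ≥0 → Ω → E} {𝒢 : Filtration ℝ≥0 mΩ}
    (hD : Martingale D 𝒢 P) {g : ℕ → ℝ≥0} (hg : Monotone g) (n : ℕ) (ε : ℝ≥0) :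
    ε * P {ω | ∃ i ≤ n, (ε : ℝ) ≤ ‖D (g i) ω‖} ≤ eLpNorm (D (g n)) 1 P := by
  let 𝒢' : Filtration ℕ mΩ := ⟨fun i => 𝒢 (g i), fun i j hij => 𝒢.mono (hg hij),
    fun i => 𝒢.le (g i)⟩
  have hsub : Submartingale (fun i ω => ‖D (g i) ω‖) 𝒢' P := by
    have h := submartingale_norm hD
    exact ⟨fun i => h.1 (g i), fun i j hij => h.2.1 _ _ (hg hij), fun i => h.2.2 (g i)⟩
  have h := maximal_ineq hsub (fun i ω => norm_nonneg _) (ε := ε) n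
  have e : {ω | (ε : ℝ) ≤ (Finset.range (n + 1)).sup' Finset.nonempty_range_add_one
      fun k => ‖D (g k) ω‖} = {ω | ∃ i ≤ n, (ε : ℝ) ≤ ‖D (g i) ω‖} := by
    ext ω
    simp only [Set.mem_ofPred_eq, Finset.le_sup'_iff, Finset.mem_range, Nat.lt_succ_iff]
  rw [e] at h
  refine h.trans ?_
  rw [eLpNorm_one_eq_lintegral_enorm, ← ofReal_integral_norm_eq_lintegral_enorm
    (hD.integrable _)]
  exact ENNReal.ofReal_le_ofReal (setIntegral_le_integral (hD.integrable _).norm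
    (Eventually.of_forall fun ω => norm_nonneg _))

/-- **Doob's maximal inequality** for a martingale with continuous paths. -/
lemma measure_exists_lt_norm_le {D : ℝ≥0 → Ω → E} {𝒢 : Filtration ℝ≥0 mΩ}
    (hD : Martingale D 𝒢 P) (hc : ∀ᵐ ω ∂P, Continuous fun t => D t ω) (S ε : ℝ≥0) :
    ε * P {ω | ∃ t ≤ S, (ε : ℝ) < ‖D t ω‖} ≤ eLpNorm (D S) 1 P := by
  set g : ℕ → ℕ → ℝ≥0 := fun n i => S * (i / ((n + 1 : ℕ) : ℝ≥0)) with hg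
  have hgm : ∀ n, Monotone (g n) := fun n i j hij => by
    simp only [hg]
    gcongr
  have hgn : ∀ n, g n (n + 1) = S := fun n => by
    simp only [hg]
    rw [div_self (by positivity), mul_one]
  set A : ℕ → Set Ω := fun n => {ω | ∃ i ≤ n + 1, (ε : ℝ) ≤ ‖D (g n i) ω‖} with hA
  have hAle : ∀ n, ε * P (A n) ≤ eLpNorm (D S) 1 P := fun n => by
    have := measure_exists_le_norm_le hD (hgm n) (n + 1) ε
    rwa [hgn] at this
  -- The grids are not nested, so the events `A n` need not increase. Their lower limit is an
  -- increasing union, and it contains the event in question: a continuous path strictly above `ε`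
  -- at `t` is above `ε` at the grid point just below `t` for all large `n`.
  have hmono : Monotone fun N => ⋂ n ≥ N, A n := fun N N' h =>
    Set.biInter_subset_biInter_left fun n hn => h.trans hn
  have hsub : P {ω | ∃ t ≤ S, (ε : ℝ) < ‖D t ω‖} ≤ P (⋃ N, ⋂ n ≥ N, A n) := by
    refine measure_mono_ae ?_
    filter_upwards [hc] with ω hω
    rintro ⟨t, htS, ht⟩
    have ht1 : t / S ≤ 1 := div_le_one_of_le₀ htS zero_le
    have hlim : Tendsto (fun n : ℕ => g n ⌊t / S * ((n + 1 : ℕ) : ℝ≥0)⌋₊) atTop (𝓝 t) := by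
      have h1 : Tendsto (fun x : ℝ => ((⌊((t / S : ℝ≥0) : ℝ) * x⌋₊ : ℕ) : ℝ) / x) atTop
          (𝓝 ((t / S : ℝ≥0) : ℝ)) := tendsto_nat_floor_mul_div_atTop (NNReal.coe_nonneg _)
      have h2 := h1.comp (tendsto_natCast_atTop_atTop.comp (tendsto_add_atTop_nat 1))
      have h3 : Tendsto (fun n : ℕ => (⌊t / S * ((n + 1 : ℕ) : ℝ≥0)⌋₊ : ℝ≥0) /
          ((n + 1 : ℕ) : ℝ≥0)) atTop (𝓝 (t / S)) := by
        rw [← NNReal.tendsto_coe]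
        refine h2.congr fun n => ?_
        simp only [Function.comp, NNReal.coe_div, NNReal.coe_natCast]
        congr 2
      have h4 := h3.const_mul S
      have e : S * (t / S) = t := by
        rcases eq_or_ne S 0 with h | h
        · rw [h] at htS ⊢
          rw [zero_mul, nonpos_iff_eq_zero.1 htS]
        · field_simp
      rwa [e] at h4
    have hev := ((hω.norm.tendsto t).comp hlim).eventually (lt_mem_nhds ht)
    obtain ⟨N, hN⟩ := eventually_atTop.1 hev
    refine Set.mem_iUnion.2 ⟨N, Set.mem_iInter₂.2 fun n hn => ⟨_, ?_, (hN n hn).le⟩⟩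
    refine Nat.floor_le_of_le ?_
    exact mul_le_of_le_one_left zero_le ht1
  refine (mul_le_mul_right hsub _).trans ?_
  rw [hmono.measure_iUnion, ENNReal.mul_iSup]
  refine iSup_le fun N => (mul_le_mul_right (measure_mono ?_) _).trans (hAle N)
  exact Set.iInter₂_subset N le_rfl

end Maximal

end DelayedSDE

namespace DelayedSDE

/-! ### Continuous versions of Itô integrals -/

section ContinuousVersion

set_option linter.unusedSectionVars false

variable {E : Type*} [NormedAddCommGroup E]

/-! ### Step functions: density in `L²`, continuity and adaptedness of their integrals -/

namespace StepFunction

variable [NormedSpace ℝ E]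

lemma eval_eq_val (φ : StepFunction E) {i : ℕ} (hi : i < φ.size) {r : ℝ}
    (hr : r ∈ Set.Ioc (φ.time i : ℝ) (φ.time (i + 1))) : φ.eval r = φ.val i := by
  have hmono : Monotone fun i => (φ.time i : ℝ) := fun i j hij => φ.mono hij
  rw [StepFunction.eval, Finset.sum_eq_single_of_mem i (Finset.mem_range.2 hi),
    Set.indicator_of_mem hr]
  intro j _ hj
  refine Set.indicator_of_notMem (fun h => ?_) _
  exact Set.disjoint_left.1 (hmono.pairwise_disjoint_on_Ioc_succ hj) h hr

lemma exists_mem_Ioc_time (φ : StepFunction E) {r : ℝ}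
    (hr : r ∈ Set.Ioc (φ.time 0 : ℝ) (φ.time φ.size)) :
    ∃ i < φ.size, r ∈ Set.Ioc (φ.time i : ℝ) (φ.time (i + 1)) := by
  classical
  have hex : ∃ j, r ≤ φ.time j := ⟨_, hr.2⟩
  obtain ⟨i, hi⟩ : ∃ i, Nat.find hex = i + 1 := Nat.exists_eq_succ_of_ne_zero fun h0 => by
    have := Nat.find_spec hex
    rw [h0] at this
    exact absurd hr.1 (not_lt.2 this)
  refine ⟨i, ?_, ?_, ?_⟩
  · have := Nat.find_min' hex hr.2
    omega
  · exact not_le.1 (Nat.find_min hex (m := i) (by omega))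
  · rw [← hi]; exact Nat.find_spec hex

/-- Step functions approximate continuous functions uniformly on `(0,S]`. -/
lemma exists_norm_eval_sub_le {g : ℝ → E} (hg : Continuous g) (S : ℝ≥0) {δ : ℝ} (hδ : 0 < δ) :
    ∃ φ : StepFunction E, ∀ r ∈ Set.Ioc 0 (S : ℝ), ‖φ.eval r - g r‖ ≤ δ := by
  have huc := isCompact_Icc.uniformContinuousOn_of_continuous
    (hg.continuousOn (s := Set.Icc 0 (S : ℝ)))
  obtain ⟨η, hη, h⟩ := Metric.uniformContinuousOn_iff.1 huc δ hδ
  obtain ⟨n, hn⟩ := exists_nat_gt ((S : ℝ) / η)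
  have hm : Monotone fun i : ℕ => S * (i / ((n + 1 : ℕ) : ℝ≥0)) := fun i j hij => by
    simp only
    gcongr
  refine ⟨⟨n + 1, fun i => S * (i / ((n + 1 : ℕ) : ℝ≥0)), hm,
    fun i => g ((S * (i / ((n + 1 : ℕ) : ℝ≥0)) : ℝ≥0) : ℝ)⟩, fun r hr => ?_⟩
  obtain ⟨i, hi, hri⟩ := exists_mem_Ioc_time (E := E) ⟨n + 1,
    fun i => S * (i / ((n + 1 : ℕ) : ℝ≥0)), hm,
    fun i => g ((S * (i / ((n + 1 : ℕ) : ℝ≥0)) : ℝ≥0) : ℝ)⟩ (r := r) (by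
      have : ((n + 1 : ℕ) : ℝ) ≠ 0 := by positivity
      simpa [div_self this] using hr)
  rw [eval_eq_val _ hi hri]
  simp only [NNReal.coe_mul, NNReal.coe_div, NNReal.coe_natCast] at hri ⊢
  rw [← dist_eq_norm]
  have hn0 : (0 : ℝ) < ((n + 1 : ℕ) : ℝ) := by positivity
  refine (h _ ⟨by positivity, hri.1.le.trans hr.2⟩ r ⟨hr.1.le, hr.2⟩ ?_).le
  rw [dist_comm, Real.dist_eq, abs_of_pos (sub_pos.2 hri.1)]
  have h2 : (S : ℝ) * (((i + 1 : ℕ) : ℝ) / ((n + 1 : ℕ) : ℝ)) - S * (i / ((n + 1 : ℕ) : ℝ))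
      = S / ((n + 1 : ℕ) : ℝ) := by
    push_cast
    ring
  have h3 : (S : ℝ) / ((n + 1 : ℕ) : ℝ) < η := by
    rw [div_lt_iff₀ hη] at hn
    rw [div_lt_iff₀ hn0]
    push_cast
    linarith
  linarith [hri.2]

/-- Step functions are dense in `L²([0,S])`. -/
lemma exists_eLpNorm_eval_sub_le {σ : ℝ → E} {S : ℝ≥0}
    (hσ : MemLp σ 2 (volume.restrict (Set.Ioc 0 (S : ℝ)))) {ε : ℝ≥0∞} (hε : ε ≠ 0) :
    ∃ φ : StepFunction E, eLpNorm (fun r => φ.eval r - σ r) 2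
      (volume.restrict (Set.Ioc 0 (S : ℝ))) ≤ ε := by
  have hε2 : ε / 2 ≠ 0 := (ENNReal.half_pos hε).ne'
  obtain ⟨g, hg, hgm⟩ := hσ.exists_boundedContinuous_eLpNorm_sub_le (by norm_num) hε2
  set c : ℝ≥0∞ := volume.restrict (Set.Ioc 0 (S : ℝ)) Set.univ ^ (2 : ℝ≥0∞).toReal⁻¹ with hc
  have hc' : c ≠ ∞ := by
    rw [hc]
    exact ENNReal.rpow_ne_top_of_nonneg (by positivity) (measure_ne_top _ _)
  -- A uniform error `δ` costs `c δ` in `L²`, where `c` is the square root of the length of the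
  -- interval.
  obtain ⟨δ, hδ, hδe⟩ : ∃ δ : ℝ, 0 < δ ∧ c * ENNReal.ofReal δ ≤ ε / 2 := by
    obtain ⟨δ, hδ, h⟩ := ENNReal.exists_nnreal_pos_mul_lt hc' hε2
    refine ⟨δ, hδ, ?_⟩
    rw [ENNReal.ofReal_coe_nnreal, mul_comm]
    exact h.le
  obtain ⟨φ, hφ⟩ := exists_norm_eval_sub_le g.continuous S hδ
  refine ⟨φ, ?_⟩
  have h1 : eLpNorm (fun r => φ.eval r - g r) 2 (volume.restrict (Set.Ioc 0 (S : ℝ))) ≤ ε / 2 :=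
    (eLpNorm_le_of_ae_bound ((ae_restrict_iff' measurableSet_Ioc).2
      (Eventually.of_forall hφ))).trans hδe
  have h2 : eLpNorm (fun r => g r - σ r) 2 (volume.restrict (Set.Ioc 0 (S : ℝ))) ≤ ε / 2 := by
    rwa [← eLpNorm_sub_comm] at hg
  have e : (fun r => φ.eval r - σ r) = (fun r => φ.eval r - g r) + fun r => g r - σ r := by
    funext r
    simp
  rw [e]
  refine (eLpNorm_add_le ((φ.memLp_eval 2).1.sub hgm.1) (hgm.1.sub hσ.1) (by norm_num)).trans ?_
  exact (add_le_add h1 h2).trans (ENNReal.add_halves ε).le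

lemma continuous_integral {Ω : Type*} {W : ℝ≥0 → Ω → ℝ} {ω : Ω} (h : Continuous fun t => W t ω)
    (φ : StepFunction E) : Continuous fun t => φ.integral W t ω := by
  unfold StepFunction.integral
  refine continuous_finsetSum _ fun i _ => Continuous.smul (Continuous.sub ?_ ?_) continuous_const
  · exact h.comp (continuous_const.min continuous_id)
  · exact h.comp (continuous_const.min continuous_id)

lemma stronglyMeasurable_integral {Ω : Type*} {mΩ : MeasurableSpace Ω} {W : ℝ≥0 → Ω → ℝ}
    {ℱ : Filtration ℝ≥0 mΩ} (hW : StronglyAdapted ℱ W) (φ : StepFunction E) (t : ℝ≥0) :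
    StronglyMeasurable[ℱ t] (φ.integral W t) := by
  unfold StepFunction.integral
  refine Finset.stronglyMeasurable_fun_sum _ fun i _ => StronglyMeasurable.smul_const ?_ _
  exact ((hW _).mono (ℱ.mono (min_le_right _ _))).sub ((hW _).mono (ℱ.mono (min_le_right _ _)))

lemma integral_zero_time {Ω : Type*} (W : ℝ≥0 → Ω → ℝ) (φ : StepFunction E) (ω : Ω) :
    φ.integral W 0 ω = 0 := by
  simp [StepFunction.integral]

end StepFunction

lemma stronglyMeasurable_limUnder {Ω F : Type*} [NormedAddCommGroup F] [CompleteSpace F]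
    {m : MeasurableSpace Ω} {f : ℕ → Ω → F} (hf : ∀ k, StronglyMeasurable[m] (f k)) :
    StronglyMeasurable[m] fun ω => limUnder atTop fun k => f k ω :=
  StronglyMeasurable.limUnder hf

/-- The Itô integral of a deterministic square integrable function has an adapted version with
almost surely continuous paths. -/
theorem exists_continuous_itoIntegral [InnerProductSpace ℝ E] [CompleteSpace E] {Ω : Type*}
    {mΩ : MeasurableSpace Ω} {P : Measure Ω} [IsProbabilityMeasure P] {ℱ : Filtration ℝ≥0 mΩ}
    {W : ℝ≥0 → Ω → ℝ} (hW : IsBrownianReal W P) (hWad : StronglyAdapted ℱ W) (S : ℝ≥0)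
    {σ : ℝ → E} (hσ : MemLp σ 2 (volume.restrict (Set.Ioc 0 (S : ℝ)))) :
    ∃ M : ℝ≥0 → Ω → E, (∀ t, StronglyMeasurable[ℱ t] (M t)) ∧
      (∀ᵐ ω ∂P, ContinuousOn (fun t => M t ω) (Set.Iic S)) ∧
      (∀ ω, M 0 ω = 0) ∧ ∀ t ≤ S, HasItoIntegral W P σ t (M t) := by
  have hWm : ∀ t, StronglyMeasurable (W t) := fun t => (hWad t).mono (ℱ.le t)
  have hpre := hW.toIsPreBrownianReal
  -- The martingale property is used in the natural filtration of `W`: adaptedness of `W` to `ℱ`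
  -- alone does not make increments independent of the past of `ℱ`. The filtration `ℱ` enters only
  -- through adaptedness.
  have hmart := martingale_brownian hpre hWm
  set ε : ℕ → ℝ≥0 := fun k => 2⁻¹ ^ k with hε
  have hε0 : ∀ k, ε k ≠ 0 := fun k => by simp [hε]
  have hanti : Antitone ε := pow_right_anti₀ (by positivity) (by norm_num)
  -- With `δ k = ε k ² / 2`, consecutive integrals differ by at most `2 δ k = ε k ²` in `L²`, hence
  -- in `L¹`. Doob's inequality at level `ε k` then leaves probability at most `ε k = 2⁻ᵏ`, which is
  -- summable.
  set δ : ℕ → ℝ≥0∞ := fun k => ((ε k * ε k : ℝ≥0) : ℝ≥0∞) / 2 with hδ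
  have hδanti : Antitone δ := fun k l h => by
    simp only [hδ]
    have := hanti h
    gcongr
  have hδ0 : Tendsto δ atTop (𝓝 0) := by
    have h1 : Tendsto ε atTop (𝓝 0) :=
      NNReal.tendsto_pow_atTop_nhds_zero_of_lt_one (by norm_num)
    have h2 : Tendsto (fun k => ((ε k * ε k : ℝ≥0) : ℝ≥0∞)) atTop (𝓝 ((0 * 0 : ℝ≥0) : ℝ≥0∞)) :=
      ENNReal.tendsto_coe.2 (h1.mul h1)
    have h3 := ENNReal.Tendsto.div_const h2 (b := 2) (Or.inr (by norm_num))
    simpa [hδ] using h3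
  have hφex : ∀ k, ∃ φ : StepFunction E, eLpNorm (fun r => φ.eval r - σ r) 2
      (volume.restrict (Set.Ioc 0 (S : ℝ))) ≤ δ k := fun k =>
    StepFunction.exists_eLpNorm_eval_sub_le hσ (by simp [hδ, hε0 k])
  choose φ hφ using hφex
  set I : ℕ → ℝ≥0 → Ω → E := fun k t ω => (φ k).integral W t ω with hI
  have hIm : ∀ k t, StronglyMeasurable[ℱ t] (I k t) := fun k t =>
    (φ k).stronglyMeasurable_integral hWad t
  have hIm' : ∀ k t, AEStronglyMeasurable (I k t) P := fun k t =>
    ((hIm k t).mono (ℱ.le t)).aestronglyMeasurable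
  have hφt : ∀ k, ∀ t ≤ S, eLpNorm (fun r => (φ k).eval r - σ r) 2
      (volume.restrict (Set.Ioc 0 (t : ℝ))) ≤ δ k := fun k t ht =>
    (eLpNorm_mono_measure _ (Measure.restrict_mono
      (Set.Ioc_subset_Ioc_right (NNReal.coe_le_coe.2 ht)) le_rfl)).trans (hφ k)
  have hσt : ∀ t ≤ S, AEStronglyMeasurable σ (volume.restrict (Set.Ioc 0 (t : ℝ))) :=
    fun t ht => hσ.1.mono_measure (Measure.restrict_mono
      (Set.Ioc_subset_Ioc_right (NNReal.coe_le_coe.2 ht)) le_rfl)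
  have hII : ∀ k l, ∀ t ≤ S, eLpNorm (fun ω => I k t ω - I l t ω) 2 P ≤ δ k + δ l :=
    fun k l t ht => by
      rw [hI, StepFunction.eLpNorm_integral_sub hpre]
      have e : (fun r => (φ k).eval r - (φ l).eval r)
          = (fun r => (φ k).eval r - σ r) - fun r => (φ l).eval r - σ r := by
        funext r
        simp
      rw [e]
      refine (eLpNorm_sub_le (((φ k).memLp_eval 2).1.sub (hσt t ht))
        (((φ l).memLp_eval 2).1.sub (hσt t ht)) (by norm_num)).trans ?_
      exact add_le_add (hφt k t ht) (hφt l t ht)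
  have hprob : ∀ k, P {ω | ∃ t ≤ S, (ε k : ℝ) < ‖I k t ω - I (k + 1) t ω‖} ≤ ε k := fun k => by
    have h1 := measure_exists_lt_norm_le
      (((φ k).martingale_integral hmart).sub ((φ (k + 1)).martingale_integral hmart))
      (by
        filter_upwards [hW.cont] with ω hω
        exact ((φ k).continuous_integral hω).sub ((φ (k + 1)).continuous_integral hω)) S (ε k)
    have h2 : eLpNorm (fun ω => I k S ω - I (k + 1) S ω) 1 P ≤ ε k * ε k := by
      refine (eLpNorm_le_eLpNorm_of_exponent_le (by norm_num)
        ((hIm' k S).sub (hIm' (k + 1) S))).trans ((hII k (k + 1) S le_rfl).trans ?_)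
      refine (add_le_add_right (hδanti k.le_succ) _).trans ?_
      rw [hδ]
      simp only [ENNReal.add_halves]
      push_cast
      rfl
    have h3 : (ε k : ℝ≥0∞) * P {ω | ∃ t ≤ S, (ε k : ℝ) < ‖I k t ω - I (k + 1) t ω‖}
        ≤ ε k * ε k := h1.trans h2
    exact (ENNReal.mul_le_mul_iff_right (by simpa using hε0 k) (by simp)).1 h3
  have hsum : ∑' k, P {ω | ∃ t ≤ S, (ε k : ℝ) < ‖I k t ω - I (k + 1) t ω‖} ≠ ∞ := by
    refine ne_top_of_le_ne_top ?_ (ENNReal.tsum_le_tsum hprob)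
    rw [ENNReal.tsum_coe_ne_top_iff_summable]
    exact NNReal.summable_geometric (by norm_num)
  -- The limit is taken at every `ω`, with a default value where there is none, so `M t` is `ℱ
  -- t`-measurable although `ℱ` need not contain the null sets.
  set M : ℝ≥0 → Ω → E := fun t ω => limUnder atTop fun k => I k t ω with hM
  -- By Borel–Cantelli, from a random index `N` on, the distances are dominated by a geometric
  -- series with the same constants for all `t ≤ S`; this gives uniform convergence of paths.
  have hgood : ∀ᵐ ω ∂P, ∃ N, ∀ t ≤ S, Tendsto (fun k => I k t ω) atTop (𝓝 (M t ω)) ∧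
      ∀ k, dist (I (N + k) t ω) (M t ω) ≤ (1 : ℝ) * 2⁻¹ ^ k / (1 - 2⁻¹) := by
    filter_upwards [ae_eventually_notMem hsum] with ω hω
    obtain ⟨N, hN⟩ := eventually_atTop.1 hω
    refine ⟨N, fun t ht => ?_⟩
    have hd : ∀ k, dist (I (N + k) t ω) (I (N + (k + 1)) t ω) ≤ (1 : ℝ) * 2⁻¹ ^ k := fun k => by
      have h1 : ‖I (N + k) t ω - I (N + k + 1) t ω‖ ≤ ε (N + k) := by
        by_contra hcon
        exact hN (N + k) (by omega) ⟨t, ht, not_le.1 hcon⟩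
      rw [dist_eq_norm, one_mul, ← add_assoc]
      refine h1.trans ?_
      have h2 := hanti (show k ≤ N + k by omega)
      calc (ε (N + k) : ℝ) ≤ ε k := h2
        _ = 2⁻¹ ^ k := by simp [hε]
    have hc := cauchySeq_of_le_geometric (2⁻¹ : ℝ) 1 (by norm_num) hd
    obtain ⟨a, ha⟩ := cauchySeq_tendsto_of_complete hc
    have ha' : Tendsto (fun k => I k t ω) atTop (𝓝 a) := by
      rw [← tendsto_add_atTop_iff_nat N]
      simpa only [add_comm] using ha
    have hMa : M t ω = a := ha'.limUnder_eq
    rw [hMa]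
    exact ⟨ha', dist_le_of_le_geometric_of_tendsto (2⁻¹ : ℝ) 1 (by norm_num) hd ha⟩
  refine ⟨M, fun t => ?_, ?_, fun ω => ?_, fun t ht => ?_⟩
  · exact stronglyMeasurable_limUnder fun k => hIm k t
  · filter_upwards [hgood, hW.cont] with ω hω hc
    obtain ⟨N, hN⟩ := hω
    have hu : TendstoUniformlyOn (fun k t => I (N + k) t ω) (fun t => M t ω) atTop (Set.Iic S) := by
      rw [Metric.tendstoUniformlyOn_iff]
      intro η hη
      have hlim : Tendsto (fun k : ℕ => (1 : ℝ) * 2⁻¹ ^ k / (1 - 2⁻¹)) atTop (𝓝 0) := by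
        have := ((tendsto_pow_atTop_nhds_zero_of_lt_one (r := (2⁻¹ : ℝ)) (by norm_num)
          (by norm_num)).const_mul 1).div_const (1 - 2⁻¹)
        simpa using this
      filter_upwards [hlim.eventually (gt_mem_nhds hη)] with k hk t ht
      rw [dist_comm]
      exact ((hN t ht).2 k).trans_lt hk
    exact hu.continuousOn (Frequently.of_forall fun k =>
      ((φ (N + k)).continuous_integral hc).continuousOn)
  · simp only [hM, hI, StepFunction.integral_zero_time]
    exact tendsto_const_nhds.limUnder_eq
  · have hlim : ∀ᵐ ω ∂P, Tendsto (fun k => I k t ω) atTop (𝓝 (M t ω)) := by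
      filter_upwards [hgood] with ω hω
      obtain ⟨N, hN⟩ := hω
      exact (hN t ht).1
    -- Fatou in the second index of the Cauchy estimate `hII`.
    have hle : ∀ k, eLpNorm (fun ω => I k t ω - M t ω) 2 P ≤ δ k + δ k := fun k => by
      refine (Lp.eLpNorm_lim_le_liminf_eLpNorm (f := fun l ω => I k t ω - I l t ω)
        (fun l => (hIm' k t).sub (hIm' l t)) _ ?_).trans ?_
      · filter_upwards [hlim] with ω hω
        exact hω.const_sub _
      · refine liminf_le_of_frequently_le' (Eventually.frequently ?_)
        filter_upwards [eventually_ge_atTop k] with l hl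
        exact (hII k l t ht).trans (add_le_add_right (hδanti hl) _)
    have hMm : AEStronglyMeasurable (M t) P := aestronglyMeasurable_of_tendsto_ae atTop
      (fun k => hIm' k t) hlim
    have hsub : MemLp (fun ω => I 0 t ω - M t ω) 2 P := by
      refine ⟨(hIm' 0 t).sub hMm, (hle 0).trans_lt ?_⟩
      simp only [hδ, ENNReal.add_halves]
      exact ENNReal.coe_lt_top
    refine ⟨?_, φ, ?_, ?_⟩
    · have := ((φ 0).memLp_integral hpre t).sub hsub
      refine this.congr_norm hMm (Eventually.of_forall fun ω => ?_)
      simp [hI]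
    · exact tendsto_of_tendsto_of_tendsto_of_le_of_le tendsto_const_nhds hδ0 (fun _ => zero_le)
        fun k => hφt k t ht
    · refine tendsto_of_tendsto_of_tendsto_of_le_of_le tendsto_const_nhds ?_ (fun _ => zero_le)
        hle
      simpa using hδ0.add hδ0

end ContinuousVersion

end DelayedSDE

namespace DelayedSDE

/-! ### Pathwise analysis of the equation `y + c ∫ y = m` -/

section Pathwise

variable {E : Type*} [NormedAddCommGroup E] [NormedSpace ℝ E]

/-- The `i`-th point of the equidistant partition of `[0,t]` into `k + 1` intervals. -/
noncomputable def gridPoint (t : ℝ) (k i : ℕ) : ℝ := t * (i / ((k + 1 : ℕ) : ℝ))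

lemma gridPoint_zero (t : ℝ) (k : ℕ) : gridPoint t k 0 = 0 := by simp [gridPoint]

lemma gridPoint_last (t : ℝ) (k : ℕ) : gridPoint t k (k + 1) = t := by
  have : ((k + 1 : ℕ) : ℝ) ≠ 0 := by positivity
  rw [gridPoint, div_self this, mul_one]

lemma gridPoint_mono {t : ℝ} (ht : 0 ≤ t) (k : ℕ) : Monotone (gridPoint t k) := fun i j hij => by
  unfold gridPoint
  gcongr

lemma gridPoint_nonneg {t : ℝ} (ht : 0 ≤ t) (k i : ℕ) : 0 ≤ gridPoint t k i := by
  unfold gridPoint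
  positivity

lemma gridPoint_le {t : ℝ} (ht : 0 ≤ t) {k i : ℕ} (hi : i ≤ k + 1) : gridPoint t k i ≤ t := by
  have := gridPoint_mono ht k hi
  rwa [gridPoint_last] at this

lemma gridPoint_succ_sub (t : ℝ) (k i : ℕ) :
    gridPoint t k (i + 1) - gridPoint t k i = t / ((k + 1 : ℕ) : ℝ) := by
  unfold gridPoint
  push_cast
  ring

/-- The Riemann–Stieltjes sum for `∫₀ᵗ e^{-c(t-s)} dm(s)` on the equidistant partition. -/
noncomputable def expSum (c t : ℝ) (k : ℕ) (m : ℝ → E) : E :=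
  ∑ i ∈ Finset.range (k + 1), Real.exp (-(c * (t - gridPoint t k i))) •
    (m (gridPoint t k (i + 1)) - m (gridPoint t k i))

variable [CompleteSpace E]

/-- The error of one step of the Riemann–Stieltjes sum. -/
lemma norm_exp_step_le {c a b η : ℝ} {y : ℝ → E} (hc : 0 ≤ c) (hab : a ≤ b)
    (hy : ContinuousOn y (Set.Icc a b))
    (h : ∀ s ∈ Set.Icc a b, ‖Real.exp (c * s) • y b - Real.exp (c * a) • y s‖ ≤ η) :
    ‖Real.exp (c * a) • ((y b - y a) + c • ∫ s in a..b, y s)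
      - (Real.exp (c * b) • y b - Real.exp (c * a) • y a)‖ ≤ c * η * (b - a) := by
  have hyi : IntervalIntegrable y volume a b :=
    ContinuousOn.intervalIntegrable (by rwa [Set.uIcc_of_le hab])
  have hei : IntervalIntegrable (fun s => Real.exp (c * s) • y b) volume a b :=
    Continuous.intervalIntegrable (by fun_prop) _ _
  have h1 : ∫ s in a..b, c * Real.exp (c * s) = Real.exp (c * b) - Real.exp (c * a) := by
    refine intervalIntegral.integral_eq_sub_of_hasDerivAt (f := fun s => Real.exp (c * s))
      (fun s _ => ?_) (Continuous.intervalIntegrable (by fun_prop) _ _)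
    have := ((hasDerivAt_id s).const_mul c).exp
    simp only [id] at this
    exact this.congr_deriv (by ring)
  have h2 : ∫ s in a..b, (Real.exp (c * s) • y b - Real.exp (c * a) • y s)
      = (∫ s in a..b, Real.exp (c * s)) • y b - Real.exp (c * a) • ∫ s in a..b, y s := by
    have hyi' : IntervalIntegrable (fun s => Real.exp (c * a) • y s) volume a b :=
      hyi.smul (Real.exp (c * a))
    rw [intervalIntegral.integral_sub hei hyi', intervalIntegral.integral_smul_const,
      intervalIntegral.integral_smul]
  -- Summation by parts with `e^{cb} - e^{ca} = c ∫ e^{cs} ds` puts the whole error under one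
  -- integral. Its integrand is small for merely continuous `y`; no bounded variation is needed.
  have h3 : Real.exp (c * a) • ((y b - y a) + c • ∫ s in a..b, y s)
      - (Real.exp (c * b) • y b - Real.exp (c * a) • y a)
      = -(c • ∫ s in a..b, (Real.exp (c * s) • y b - Real.exp (c * a) • y s)) := by
    rw [h2, smul_sub, smul_smul c, ← intervalIntegral.integral_const_mul, h1]
    module
  rw [h3, norm_neg, norm_smul, Real.norm_of_nonneg hc, mul_assoc]
  refine mul_le_mul_of_nonneg_left ?_ hc
  have := intervalIntegral.norm_integral_le_of_norm_le_const (a := a) (b := b) (C := η)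
    (f := fun s => Real.exp (c * s) • y b - Real.exp (c * a) • y s) fun s hs => by
      rw [Set.uIoc_of_le hab] at hs
      exact h s ⟨hs.1.le, hs.2⟩
  rwa [abs_of_nonneg (sub_nonneg.2 hab)] at this

/-- If `m = y + c ∫ y` then `y` is the limit of the Riemann–Stieltjes sums of
`∫₀ᵗ e^{-c(t-s)} dm(s)`. -/
lemma tendsto_expSum {c t : ℝ} {y m : ℝ → E} (hc : 0 ≤ c) (ht : 0 ≤ t)
    (hy : ContinuousOn y (Set.Icc 0 t)) (hy0 : y 0 = 0)
    (hm : ∀ s ∈ Set.Icc 0 t, m s = y s + c • ∫ r in (0 : ℝ)..s, y r) :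
    Tendsto (fun k => expSum c t k m) atTop (𝓝 (y t)) := by
  rw [Metric.tendsto_atTop]
  intro ε hε
  -- The step errors add up to at most `c η t`, which is below `ε`.
  set η : ℝ := ε / (c * t + 1) with hη
  have hct : 0 ≤ c * t := mul_nonneg hc ht
  have hη0 : 0 < η := by positivity
  have hF : ContinuousOn (fun p : ℝ × ℝ => Real.exp (c * p.1) • y p.2)
      (Set.Icc 0 t ×ˢ Set.Icc 0 t) := by
    refine ContinuousOn.smul (Continuous.continuousOn (by fun_prop)) ?_
    exact hy.comp continuousOn_snd fun p hp => hp.2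
  obtain ⟨δ, hδ, hu⟩ := Metric.uniformContinuousOn_iff.1
    ((isCompact_Icc.prod isCompact_Icc).uniformContinuousOn_of_continuous hF) η hη0
  obtain ⟨K, hK⟩ := exists_nat_gt (t / δ)
  refine ⟨K, fun k hk => ?_⟩
  set g := gridPoint t k with hg
  have hk0 : (0 : ℝ) < ((k + 1 : ℕ) : ℝ) := by positivity
  have hmesh : t / ((k + 1 : ℕ) : ℝ) < δ := by
    rw [div_lt_iff₀ hδ] at hK
    rw [div_lt_iff₀ hk0]
    have : (K : ℝ) ≤ ((k + 1 : ℕ) : ℝ) := by exact_mod_cast hk.trans k.le_succ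
    nlinarith
  have hstep : ∀ i ∈ Finset.range (k + 1),
      ‖Real.exp (c * g i) • (m (g (i + 1)) - m (g i))
        - (Real.exp (c * g (i + 1)) • y (g (i + 1)) - Real.exp (c * g i) • y (g i))‖
      ≤ c * η * (g (i + 1) - g i) := fun i hi => by
    have hi' : i + 1 ≤ k + 1 := Finset.mem_range.1 hi
    have ha : g i ∈ Set.Icc 0 t := ⟨gridPoint_nonneg ht k i, gridPoint_le ht (by omega)⟩
    have hb : g (i + 1) ∈ Set.Icc 0 t := ⟨gridPoint_nonneg ht k _, gridPoint_le ht hi'⟩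
    have hab : g i ≤ g (i + 1) := gridPoint_mono ht k i.le_succ
    have hsub : Set.Icc (g i) (g (i + 1)) ⊆ Set.Icc 0 t := Set.Icc_subset_Icc ha.1 hb.2
    have hyi : ∀ u ∈ Set.Icc 0 t, ∀ v ∈ Set.Icc 0 t, IntervalIntegrable y volume u v :=
      fun u hu v hv => (hy.mono (Set.uIcc_subset_Icc hu hv)).intervalIntegrable
    have h0 : (0 : ℝ) ∈ Set.Icc 0 t := ⟨le_rfl, ht⟩
    have e : m (g (i + 1)) - m (g i)
        = (y (g (i + 1)) - y (g i)) + c • ∫ s in (g i)..(g (i + 1)), y s := by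
      rw [hm _ hb, hm _ ha, ← intervalIntegral.integral_add_adjacent_intervals
        (hyi _ h0 _ ha) (hyi _ ha _ hb)]
      module
    rw [e]
    refine norm_exp_step_le hc hab (hy.mono hsub) fun s hs => ?_
    rw [← dist_eq_norm]
    refine (hu (s, g (i + 1)) ⟨hsub hs, hb⟩ (g i, s) ⟨ha, hsub hs⟩ ?_).le
    have hd : g (i + 1) - g i < δ := by rw [hg, gridPoint_succ_sub]; exact hmesh
    rw [Prod.dist_eq, max_lt_iff]
    simp only [Real.dist_eq]
    rw [abs_of_nonneg (sub_nonneg.2 hs.1), abs_of_nonneg (sub_nonneg.2 hs.2)]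
    exact ⟨by linarith [hs.2], by linarith [hs.1]⟩
  have htel : ∑ i ∈ Finset.range (k + 1),
      (Real.exp (c * g (i + 1)) • y (g (i + 1)) - Real.exp (c * g i) • y (g i))
      = Real.exp (c * t) • y t := by
    rw [Finset.sum_range_sub (fun i => Real.exp (c * g i) • y (g i)), hg, gridPoint_last,
      gridPoint_zero, hy0, smul_zero, sub_zero]
  have hsum : expSum c t k m - y t = Real.exp (-(c * t)) • ∑ i ∈ Finset.range (k + 1),
      (Real.exp (c * g i) • (m (g (i + 1)) - m (g i))
        - (Real.exp (c * g (i + 1)) • y (g (i + 1)) - Real.exp (c * g i) • y (g i))) := by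
    rw [Finset.sum_sub_distrib, htel, smul_sub, smul_smul, ← Real.exp_add, neg_add_cancel,
      Real.exp_zero, one_smul, expSum, Finset.smul_sum]
    congr 1
    refine Finset.sum_congr rfl fun i _ => ?_
    rw [smul_smul, ← Real.exp_add]
    congr 2
    ring
  rw [dist_eq_norm, hsum, norm_smul, Real.norm_of_nonneg (Real.exp_pos _).le]
  have h1 : Real.exp (-(c * t)) ≤ 1 := Real.exp_le_one_iff.2 (by linarith)
  have h2 := (norm_sum_le _ _).trans (Finset.sum_le_sum hstep)
  rw [← Finset.mul_sum, Finset.sum_range_sub, hg, gridPoint_last, gridPoint_zero, sub_zero] at h2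
  calc _ ≤ 1 * (c * η * t) := mul_le_mul h1 h2 (norm_nonneg _) zero_le_one
    _ = ε * (c * t / (c * t + 1)) := by rw [hη]; ring
    _ < ε * 1 := by
      refine mul_lt_mul_of_pos_left ?_ hε
      rw [div_lt_one (by positivity)]
      linarith
    _ = ε := mul_one ε

/-- Solvability of `y + c ∫ y = m` for a continuous right-hand side. -/
lemma exists_add_integral_eq {m : ℝ → E} {S : ℝ} (hS : 0 ≤ S) (c : ℝ)
    (hm : ContinuousOn m (Set.Icc 0 S)) : ∃ y : ℝ → E, ContinuousOn y (Set.Icc 0 S) ∧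
      ∀ t ∈ Set.Icc 0 S, m t = y t + c • ∫ r in (0 : ℝ)..t, y r := by
  set m' : ℝ → E := fun r => m (Set.projIcc 0 S hS r) with hm'
  have hm'c : Continuous m' :=
    (continuousOn_iff_continuous_domRestrict.1 hm).comp continuous_projIcc
  set G : ℝ → E := fun t => ∫ s in (0 : ℝ)..t, Real.exp (c * s) • m' s with hG
  have hint : Continuous fun s => Real.exp (c * s) • m' s := by fun_prop
  have hGd : ∀ t, HasDerivAt G (Real.exp (c * t) • m' t) t := fun t =>
    intervalIntegral.integral_hasDerivAt_right (hint.intervalIntegrable _ _)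
      (hint.stronglyMeasurableAtFilter _ _) hint.continuousAt
  -- `F` is the sought primitive of `y`: it solves `F' = m' - c F` with `F 0 = 0`, and `y = F'`. The
  -- right-hand side is never differentiated.
  set F : ℝ → E := fun t => Real.exp (-(c * t)) • G t with hF
  have hFd : ∀ t, HasDerivAt F (m' t - c • F t) t := fun t => by
    have h1 := (((hasDerivAt_id t).const_mul c).fun_neg).exp
    simp only [id] at h1
    have h2 := h1.smul (hGd t)
    refine h2.congr_deriv ?_
    rw [smul_smul, ← Real.exp_add, neg_add_cancel, Real.exp_zero, hF]
    module
  have hFc : Continuous F := continuous_iff_continuousAt.2 fun t => (hFd t).continuousAt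
  have hyc : Continuous fun t => m' t - c • F t := hm'c.sub (hFc.const_smul c)
  refine ⟨fun t => m' t - c • F t, hyc.continuousOn, fun t ht => ?_⟩
  rw [intervalIntegral.integral_eq_sub_of_hasDerivAt (fun r _ => hFd r)
    (hyc.intervalIntegrable _ _)]
  have h0 : F 0 = 0 := by simp [hF, hG]
  have h1 : m' t = m t := by simp only [hm', Set.projIcc_of_mem hS ht]
  rw [h0, sub_zero, sub_add_cancel, h1]

end Pathwise

end DelayedSDE

namespace DelayedSDE

/-! ### The linear equation `dY = -c Y dt + σ dW` -/

section LinearSDE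

set_option linter.unusedSectionVars false

variable {Ω E : Type*} {mΩ : MeasurableSpace Ω} {P : Measure Ω} {ℱ : Filtration ℝ≥0 mΩ}
  {W : ℝ≥0 → Ω → ℝ} [NormedAddCommGroup E]

lemma HasItoIntegral.congr [NormedSpace ℝ E] {σ : ℝ → E} {t : ℝ≥0} {J J' : Ω → E}
    (hJ : HasItoIntegral W P σ t J) (h : J =ᵐ[P] J') : HasItoIntegral W P σ t J' := by
  obtain ⟨h1, φ, h2, h3⟩ := hJ
  refine ⟨(memLp_congr_ae h).1 h1, φ, h2, h3.congr fun k => eLpNorm_congr_ae ?_⟩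
  filter_upwards [h] with ω hω
  rw [hω]

variable [InnerProductSpace ℝ E] [CompleteSpace E]

/-- Existence of a solution of `dY = -c Y dt + σ dW`, `Y(0) = 0`. -/
theorem exists_solvesSDE [IsProbabilityMeasure P] (hW : IsBrownianReal W P)
    (hWad : StronglyAdapted ℱ W) {S c : ℝ} (hS : 0 ≤ S) (hc : 0 ≤ c) {σ : ℝ → E}
    (hσ : MemLp σ 2 (volume.restrict (Set.Ioc 0 S))) :
    ∃ Y : ℝ → Ω → E, SolvesSDE P ℱ W S (fun t ω => -c • Y t ω) σ Y := by
  lift S to ℝ≥0 using hS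
  obtain ⟨M, hMm, hMc, hM0, hMi⟩ := exists_continuous_itoIntegral hW hWad S hσ
  set m : Ω → ℝ → E := fun ω r => M r.toNNReal ω with hm
  -- Defining `Y` by the sums, not by the pathwise solution, makes it adapted: `expSum c t k` sees
  -- `M` only at times up to `t`. On paths where `M` is continuous the two agree.
  set Y : ℝ → Ω → E := fun t ω => limUnder atTop fun k => expSum c t k (m ω) with hY
  have hgood : ∀ᵐ ω ∂P, ContinuousOn (fun t => Y t ω) (Set.Icc 0 S) ∧ Y 0 ω = 0 ∧
      ∀ t ∈ Set.Icc (0 : ℝ) S, m ω t = Y t ω + c • ∫ r in (0 : ℝ)..t, Y r ω := by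
    filter_upwards [hMc] with ω hω
    have hmc : ContinuousOn (m ω) (Set.Icc 0 S) :=
      hω.comp continuous_real_toNNReal.continuousOn fun t ht => Real.toNNReal_le_iff_le_coe.2 ht.2
    obtain ⟨y, hyc, hy⟩ := exists_add_integral_eq S.coe_nonneg c hmc
    have hy0 : y 0 = 0 := by
      have := hy 0 ⟨le_rfl, S.coe_nonneg⟩
      simpa [hm, hM0] using this.symm
    have hYy : ∀ t ∈ Set.Icc (0 : ℝ) S, Y t ω = y t := fun t ht =>
      (tendsto_expSum hc ht.1 (hyc.mono (Set.Icc_subset_Icc_right ht.2)) hy0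
        fun s hs => hy s ⟨hs.1, hs.2.trans ht.2⟩).limUnder_eq
    refine ⟨hyc.congr hYy, (hYy 0 ⟨le_rfl, S.coe_nonneg⟩).trans hy0, fun t ht => ?_⟩
    rw [hy t ht, hYy t ht]
    congr 2
    refine intervalIntegral.integral_congr fun r hr => (hYy r ?_).symm
    exact Set.uIcc_subset_Icc ⟨le_rfl, S.coe_nonneg⟩ ht hr
  refine ⟨Y, fun t _ => ?_, hgood.mono fun ω h => h.1, hgood.mono fun ω h => h.2.1,
    hgood.mono fun ω h => ?_, fun t ht => ?_⟩
  · refine stronglyMeasurable_limUnder fun k => ?_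
    refine Finset.stronglyMeasurable_fun_sum _ fun i hi => StronglyMeasurable.const_smul ?_ _
    have hle : ∀ j ≤ k + 1, (gridPoint t k j).toNNReal ≤ t := fun j hj =>
      Real.toNNReal_le_iff_le_coe.2 (gridPoint_le t.coe_nonneg hj)
    have hi' : i + 1 ≤ k + 1 := Finset.mem_range.1 hi
    exact ((hMm _).mono (ℱ.mono (hle _ hi'))).sub ((hMm _).mono (ℱ.mono (hle _ (by omega))))
  · exact (h.1.const_smul (-c)).integrableOn_compact isCompact_Icc
  · refine (hMi t (NNReal.coe_le_coe.1 ht)).congr ?_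
    filter_upwards [hgood] with ω hω
    have := hω.2.2 t ⟨t.coe_nonneg, ht⟩
    simp only [hm, Real.toNNReal_coe] at this
    rw [this, intervalIntegral.integral_smul]
    module

variable {S c : ℝ} {σ : ℝ → E} {Y Y' : ℝ → Ω → E}

/-- The martingale part of a solution. -/
lemma SolvesSDE.hasItoIntegral (hY : SolvesSDE P ℱ W S (fun t ω => -c • Y t ω) σ Y) {t : ℝ≥0}
    (ht : (t : ℝ) ≤ S) :
    HasItoIntegral W P σ t (fun ω => Y t ω + c • ∫ r in (0 : ℝ)..t, Y r ω) := by
  refine (hY.equation t ht).congr (Eventually.of_forall fun ω => ?_)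
  simp only [intervalIntegral.integral_smul]
  module

lemma continuousOn_add_smul_integral {y : ℝ → E} (hS : 0 ≤ S) (hy : ContinuousOn y (Set.Icc 0 S)) :
    ContinuousOn (fun t => y t + c • ∫ r in (0 : ℝ)..t, y r) (Set.Icc 0 S) := by
  have h := intervalIntegral.continuousOn_primitive_interval' (μ := volume) (f := y) (a := 0)
    (b₁ := 0) (b₂ := S) (by rw [← Set.uIcc_of_le hS] at hy; exact hy.intervalIntegrable)
    Set.left_mem_uIcc
  rw [Set.uIcc_of_le hS] at h
  exact hy.add (h.const_smul c)

/-- Uniqueness up to indistinguishability for `dY = -c Y dt + σ dW`, `Y(0) = 0`. -/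
theorem SolvesSDE.indistinguishable [IsProbabilityMeasure P] (hW : IsPreBrownianReal W P)
    (hS : 0 ≤ S) (hσ : MemLp σ 2 (volume.restrict (Set.Ioc 0 S)))
    (hY : SolvesSDE P ℱ W S (fun t ω => -c • Y t ω) σ Y)
    (hY' : SolvesSDE P ℱ W S (fun t ω => -c • Y' t ω) σ Y') :
    ∀ᵐ ω ∂P, ∀ t ∈ Set.Icc 0 S, Y t ω = Y' t ω := by
  -- The exceptional null set of the equation depends on the time, so it is first collected over
  -- countably many times.
  obtain ⟨D, hDc, hDd⟩ := TopologicalSpace.exists_countable_dense (Set.Icc 0 S)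
  have hD : ∀ᵐ ω ∂P, ∀ t ∈ D, Y t ω + c • ∫ r in (0 : ℝ)..t, Y r ω
      = Y' t ω + c • ∫ r in (0 : ℝ)..t, Y' r ω := by
    rw [ae_ball_iff hDc]
    intro t _
    have h1 := hY.hasItoIntegral (t := ⟨t, t.2.1⟩) t.2.2
    have h2 := hY'.hasItoIntegral (t := ⟨t, t.2.1⟩) t.2.2
    exact h1.ae_eq hW (hσ.mono_measure (Measure.restrict_mono
      (Set.Ioc_subset_Ioc_right t.2.2) le_rfl)) h2
  filter_upwards [hD, hY.continuous, hY'.continuous] with ω hω hc1 hc2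
  have heq : ∀ t ∈ Set.Icc 0 S, Y t ω + c • ∫ r in (0 : ℝ)..t, Y r ω
      = Y' t ω + c • ∫ r in (0 : ℝ)..t, Y' r ω := fun t ht => by
    have := Continuous.ext_on hDd
      (continuousOn_iff_continuous_domRestrict.1 (continuousOn_add_smul_integral (c := c) hS hc1))
      (continuousOn_iff_continuous_domRestrict.1 (continuousOn_add_smul_integral (c := c) hS hc2))
      fun t ht => hω t ht
    exact congr_fun this ⟨t, ht⟩
  have h0 : (0 : ℝ) ∈ Set.Icc 0 S := ⟨le_rfl, hS⟩
  have key := eq_zero_of_norm_le_abs_integral (D := fun t => Y t ω - Y' t ω) (C := |c|)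
    (abs_nonneg c) h0 (hc1.sub hc2) fun t ht => ?_
  · exact fun t ht => sub_eq_zero.1 (key t ht)
  · have hi : ∀ {y : ℝ → E}, ContinuousOn y (Set.Icc 0 S) → IntervalIntegrable y volume 0 t :=
      fun hy => (hy.mono (Set.uIcc_subset_Icc h0 ht)).intervalIntegrable
    have e : Y t ω - Y' t ω = -(c • ∫ r in (0 : ℝ)..t, (Y r ω - Y' r ω)) := by
      rw [intervalIntegral.integral_sub (hi hc1) (hi hc2), smul_sub, neg_sub,
        eq_sub_iff_add_eq, sub_add_eq_add_sub, sub_eq_iff_eq_add, heq t ht, add_comm]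
    rw [e, norm_neg, norm_smul, Real.norm_eq_abs]
    refine mul_le_mul_of_nonneg_left ?_ (abs_nonneg c)
    exact intervalIntegral.norm_integral_le_abs_integral_norm

/-- Discrete second moment estimate for processes with orthogonal increments. -/
lemma integral_norm_sq_expSum_le {J : ℝ → Ω → E} {V : ℝ → ℝ} {t s : ℝ} (hc : 0 < c) (ht : 0 ≤ t)
    (hJ : ∀ u ∈ Set.Icc 0 t, MemLp (J u) 2 P)
    (hcov : ∀ u ∈ Set.Icc 0 t, ∀ v ∈ Set.Icc 0 t, ∫ ω, inner ℝ (J u ω) (J v ω) ∂P = V (min u v))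
    (hV : ∀ a ∈ Set.Icc 0 t, ∀ b ∈ Set.Icc 0 t, a ≤ b → V b - V a ≤ s ^ 2 * (b - a)) (k : ℕ) :
    ∫ ω, ‖expSum c t k (fun u => J u ω)‖ ^ 2 ∂P ≤ s ^ 2 / (2 * c) := by
  set g := gridPoint t k with hg
  have hmem : ∀ i ≤ k + 1, g i ∈ Set.Icc 0 t := fun i hi =>
    ⟨gridPoint_nonneg ht k i, gridPoint_le ht hi⟩
  have hmono : Monotone g := gridPoint_mono ht k
  set w : ℕ → ℝ := fun i => Real.exp (-(c * (t - g i))) with hw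
  have hΔ : ∀ i ∈ Finset.range (k + 1), MemLp (fun ω => J (g (i + 1)) ω - J (g i) ω) 2 P :=
    fun i hi => by
      have hi' := Finset.mem_range.1 hi
      exact (hJ _ (hmem _ hi')).sub (hJ _ (hmem _ hi'.le))
  have hin : ∀ i ≤ k + 1, ∀ j ≤ k + 1, Integrable (fun ω => inner ℝ (J (g i) ω) (J (g j) ω)) P :=
    fun i hi j hj => integrable_inner_of_memLp (hJ _ (hmem i hi)) (hJ _ (hmem j hj))
  -- A covariance depending only on `min u v` makes increments over disjoint intervals orthogonal.
  have horth : ∀ i ∈ Finset.range (k + 1), ∀ j ∈ Finset.range (k + 1),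
      ∫ ω, inner ℝ (J (g (i + 1)) ω - J (g i) ω) (J (g (j + 1)) ω - J (g j) ω) ∂P
        = if i = j then V (g (i + 1)) - V (g i) else 0 := fun i hi j hj => by
    have hi' : i + 1 ≤ k + 1 := Finset.mem_range.1 hi
    have hj' : j + 1 ≤ k + 1 := Finset.mem_range.1 hj
    have hi'' : i ≤ k + 1 := by omega
    have hj'' : j ≤ k + 1 := by omega
    simp only [inner_sub_left, inner_sub_right]
    rw [integral_sub ((hin _ hi' _ hj').sub' (hin _ hi'' _ hj'))
      ((hin _ hi' _ hj'').sub' (hin _ hi'' _ hj'')),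
      integral_sub (hin _ hi' _ hj') (hin _ hi'' _ hj'),
      integral_sub (hin _ hi' _ hj'') (hin _ hi'' _ hj''),
      hcov _ (hmem _ hi') _ (hmem _ hj'), hcov _ (hmem _ hi'') _ (hmem _ hj'),
      hcov _ (hmem _ hi') _ (hmem _ hj''), hcov _ (hmem _ hi'') _ (hmem _ hj''),
      ← hmono.map_min, ← hmono.map_min, ← hmono.map_min, ← hmono.map_min]
    rcases lt_trichotomy i j with h | h | h
    · rw [if_neg h.ne, min_eq_left (by omega : i + 1 ≤ j + 1), min_eq_left (by omega : i + 1 ≤ j),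
        min_eq_left (by omega : i ≤ j + 1), min_eq_left h.le]
      ring
    · subst h
      rw [if_pos rfl, min_self, min_self, min_eq_right i.le_succ, min_eq_left i.le_succ]
      ring
    · rw [if_neg h.ne', min_eq_right (by omega : j + 1 ≤ i + 1),
        min_eq_right (by omega : j ≤ i + 1), min_eq_right (by omega : j + 1 ≤ i),
        min_eq_right h.le]
      ring
  have hexp : ∫ ω, ‖expSum c t k (fun u => J u ω)‖ ^ 2 ∂P
      = ∑ i ∈ Finset.range (k + 1), w i ^ 2 * (V (g (i + 1)) - V (g i)) := by
    simp only [expSum, ← real_inner_self_eq_norm_sq, sum_inner, inner_sum, real_inner_smul_left,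
      real_inner_smul_right]
    have hi2 : ∀ i ∈ Finset.range (k + 1), ∀ j ∈ Finset.range (k + 1), Integrable (fun ω =>
        w i * (w j * inner ℝ (J (g (j + 1)) ω - J (g j) ω) (J (g (i + 1)) ω - J (g i) ω))) P :=
      fun i hi j hj => ((integrable_inner_of_memLp (hΔ j hj) (hΔ i hi)).const_mul _).const_mul _
    change ∫ ω, ∑ i ∈ Finset.range (k + 1), ∑ j ∈ Finset.range (k + 1), w i * (w j *
      inner ℝ (J (g (j + 1)) ω - J (g j) ω) (J (g (i + 1)) ω - J (g i) ω)) ∂P = _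
    rw [integral_finsetSum _ fun j hj => integrable_finsetSum _ fun i hi => hi2 j hj i hi]
    refine Finset.sum_congr rfl fun i hi => ?_
    rw [integral_finsetSum _ fun j hj => hi2 i hi j hj, Finset.sum_eq_single_of_mem i hi]
    · rw [integral_const_mul, integral_const_mul, horth i hi i hi, if_pos rfl]
      ring
    · intro j hj hji
      rw [integral_const_mul, integral_const_mul, horth j hj i hi, if_neg hji, mul_zero,
        mul_zero]
  rw [hexp]
  -- Since `1 + x ≤ e^x`, the left-endpoint sum of `e^{-2c(t-r)}` is below its integral; the bound
  -- telescopes to `1 - w 0 ²`, whence the factor `1 / (2c)` for every partition.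
  have hstep : ∀ i ∈ Finset.range (k + 1), w i ^ 2 * (V (g (i + 1)) - V (g i))
      ≤ s ^ 2 / (2 * c) * (w (i + 1) ^ 2 - w i ^ 2) := fun i hi => by
    have hi' : i + 1 ≤ k + 1 := Finset.mem_range.1 hi
    have h1 := hV _ (hmem i (by omega)) _ (hmem _ hi') (hmono i.le_succ)
    have h2 : w (i + 1) ^ 2 = w i ^ 2 * Real.exp (2 * c * (g (i + 1) - g i)) := by
      simp only [hw, ← Real.exp_nat_mul, ← Real.exp_add]
      congr 1
      push_cast
      ring
    have h3 := Real.add_one_le_exp (2 * c * (g (i + 1) - g i))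
    calc w i ^ 2 * (V (g (i + 1)) - V (g i))
        ≤ w i ^ 2 * (s ^ 2 * (g (i + 1) - g i)) := mul_le_mul_of_nonneg_left h1 (sq_nonneg _)
      _ = w i ^ 2 * (s ^ 2 / (2 * c)) * (2 * c * (g (i + 1) - g i)) := by
        field_simp
      _ ≤ w i ^ 2 * (s ^ 2 / (2 * c)) * (Real.exp (2 * c * (g (i + 1) - g i)) - 1) :=
        mul_le_mul_of_nonneg_left (by linarith) (by positivity)
      _ = _ := by rw [h2]; ring
  refine (Finset.sum_le_sum hstep).trans ?_
  rw [← Finset.mul_sum, Finset.sum_range_sub (fun i => w i ^ 2)]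
  have hlast : w (k + 1) ^ 2 = 1 := by
    simp only [hw, hg, gridPoint_last, sub_self, mul_zero, neg_zero, Real.exp_zero, one_pow]
  rw [hlast]
  exact mul_le_of_le_one_right (by positivity) (by linarith [sq_nonneg (w 0)])

/-- The stationary second moment bound for `dY = -c Y dt + σ dW`, `Y(0) = 0`. -/
theorem SolvesSDE.eLpNorm_le [IsProbabilityMeasure P] (hW : IsPreBrownianReal W P) {s : ℝ}
    (hc : 0 < c) (hσ : MemLp σ 2 (volume.restrict (Set.Ioc 0 S)))
    (hs : ∀ᵐ r ∂(volume.restrict (Set.Ioc 0 S)), ‖σ r‖ ≤ s)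
    (hY : SolvesSDE P ℱ W S (fun t ω => -c • Y t ω) σ Y) {t : ℝ} (ht : t ∈ Set.Icc 0 S) :
    eLpNorm (Y t) 2 P ≤ ENNReal.ofReal (√(s ^ 2 / (2 * c))) := by
  set J : ℝ → Ω → E := fun u ω => Y u ω + c • ∫ r in (0 : ℝ)..u, Y r ω with hJdef
  have hJ : ∀ u : ℝ, ∀ hu : u ∈ Set.Icc 0 t, HasItoIntegral W P σ ⟨u, hu.1⟩ (J u) :=
    fun u hu => hY.hasItoIntegral (t := ⟨u, hu.1⟩) (hu.2.trans ht.2)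
  set V : ℝ → ℝ := fun u => ∫ r in Set.Ioc 0 u, ‖σ r‖ ^ 2 with hVdef
  have hcov : ∀ u ∈ Set.Icc 0 t, ∀ v ∈ Set.Icc 0 t,
      ∫ ω, inner ℝ (J u ω) (J v ω) ∂P = V (min u v) := fun u hu v hv =>
    (hJ u hu).integral_inner hW (hσ.mono_measure (Measure.restrict_mono
      (Set.Ioc_subset_Ioc_right (max_le (hu.2.trans ht.2) (hv.2.trans ht.2))) le_rfl)) (hJ v hv)
  have hV : ∀ a ∈ Set.Icc 0 t, ∀ b ∈ Set.Icc 0 t, a ≤ b → V b - V a ≤ s ^ 2 * (b - a) :=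
    fun a ha b hb hab => by
      have hi : IntegrableOn (fun r => ‖σ r‖ ^ 2) (Set.Ioc 0 S) := integrable_norm_sq hσ
      have hsub : Set.Ioc a b ⊆ Set.Ioc 0 S := Set.Ioc_subset_Ioc ha.1 (hb.2.trans ht.2)
      have e : V b = V a + ∫ r in Set.Ioc a b, ‖σ r‖ ^ 2 := by
        rw [hVdef]
        simp only
        rw [← setIntegral_union (Set.Ioc_disjoint_Ioc_of_le le_rfl) measurableSet_Ioc
          (hi.mono_set (Set.Ioc_subset_Ioc_right (ha.2.trans ht.2))) (hi.mono_set hsub),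
          Set.Ioc_union_Ioc_eq_Ioc ha.1 hab]
      rw [e, add_sub_cancel_left]
      have h1 : ∫ r in Set.Ioc a b, ‖σ r‖ ^ 2 ≤ ∫ r in Set.Ioc a b, s ^ 2 := by
        refine integral_mono_ae (hi.mono_set hsub) (integrable_const _) ?_
        filter_upwards [ae_restrict_of_ae_restrict_of_subset hsub hs] with r hr
        exact pow_le_pow_left₀ (norm_nonneg _) hr 2
      refine h1.trans (le_of_eq ?_)
      rw [setIntegral_const, Real.volume_real_Ioc_of_le hab, smul_eq_mul, mul_comm]
  have hmom := integral_norm_sq_expSum_le (P := P) hc ht.1 (fun u hu => (hJ u hu).1) hcov hV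
  have hXm : ∀ k, MemLp (fun ω => expSum c t k (fun u => J u ω)) 2 P := fun k => by
    refine memLp_finsetSum _ fun i hi => MemLp.const_smul ?_ _
    have hi' : i + 1 ≤ k + 1 := Finset.mem_range.1 hi
    exact (hJ _ ⟨gridPoint_nonneg ht.1 k _, gridPoint_le ht.1 hi'⟩).1.sub
      (hJ _ ⟨gridPoint_nonneg ht.1 k _, gridPoint_le ht.1 (by omega)⟩).1
  -- Fatou: almost surely the sums converge to `Y t`, and each has second moment at most `s² /
  -- (2c)`.
  refine (Lp.eLpNorm_lim_le_liminf_eLpNorm (fun k => (hXm k).1) (Y t) ?_).trans ?_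
  · filter_upwards [hY.continuous, hY.initial] with ω h1 h2
    exact tendsto_expSum hc.le ht.1 (h1.mono (Set.Icc_subset_Icc_right ht.2)) h2 fun s _ => rfl
  · refine liminf_le_of_frequently_le' (Frequently.of_forall fun k => ?_)
    rw [eLpNorm_two_eq (hXm k)]
    exact ENNReal.ofReal_le_ofReal (Real.sqrt_le_sqrt (hmom k))

/-- A process with almost surely continuous paths is jointly measurable. -/
lemma aestronglyMeasurable_uncurry_of_continuousOn [IsProbabilityMeasure P]
    [SecondCountableTopology E] (hS : 0 < S)
    (hm : ∀ t ∈ Set.Icc 0 S, StronglyMeasurable (Y t))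
    (hc : ∀ᵐ ω ∂P, ContinuousOn (fun t => Y t ω) (Set.Icc 0 S)) :
    AEStronglyMeasurable (fun p : ℝ × Ω => Y p.1 p.2)
      ((volume.restrict (Set.Icc 0 S)).prod P) := by
  borelize E
  -- Time is rounded down to the grid. The cap `k + 1` keeps grid points below `S` even for `r`
  -- outside `[0,S]`, where `Y` is not known to be measurable; countably many time values then give
  -- joint measurability.
  set q : ℕ → ℝ → ℕ := fun k r => min ⌊r / S * ((k + 1 : ℕ) : ℝ)⌋₊ (k + 1) with hq
  have hqm : ∀ k, Measurable (q k) := fun k => by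
    have : Measurable fun r : ℝ => ⌊r / S * ((k + 1 : ℕ) : ℝ)⌋₊ :=
      Nat.measurable_floor.comp (by fun_prop)
    exact this.min measurable_const
  have hgq : ∀ k r, gridPoint S k (q k r) ∈ Set.Icc 0 S := fun k r =>
    ⟨gridPoint_nonneg hS.le _ _, gridPoint_le hS.le (min_le_right _ _)⟩
  refine aestronglyMeasurable_of_tendsto_ae atTop
    (f := fun k (p : ℝ × Ω) => Y (gridPoint S k (q k p.1)) p.2) (fun k => ?_) ?_
  · have h1 : Measurable fun p : ℕ × Ω => Y (gridPoint S k (min p.1 (k + 1))) p.2 :=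
      measurable_from_prod_countable_right fun i =>
        (hm _ ⟨gridPoint_nonneg hS.le _ _, gridPoint_le hS.le (min_le_right _ _)⟩).measurable
    have h2 := h1.comp (((hqm k).comp measurable_fst).prodMk (measurable_snd (α := ℝ) (β := Ω)))
    refine Measurable.aestronglyMeasurable ?_
    convert h2 using 2 with p
    simp [hq]
  · filter_upwards [Measure.quasiMeasurePreserving_fst.ae (ae_restrict_mem measurableSet_Icc),
      Measure.quasiMeasurePreserving_snd.ae hc] with p hp1 hp2
    have hlim : Tendsto (fun k => gridPoint S k (q k p.1)) atTop (𝓝 p.1) := by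
      have h1 : Tendsto (fun x : ℝ => ((⌊p.1 / S * x⌋₊ : ℕ) : ℝ) / x) atTop (𝓝 (p.1 / S)) :=
        tendsto_nat_floor_mul_div_atTop (div_nonneg hp1.1 hS.le)
      have h2 := (h1.comp (tendsto_natCast_atTop_atTop.comp (tendsto_add_atTop_nat 1))).const_mul S
      rw [mul_div_cancel₀ _ hS.ne'] at h2
      refine h2.congr fun k => ?_
      have h3 : ⌊p.1 / S * ((k + 1 : ℕ) : ℝ)⌋₊ ≤ k + 1 := Nat.floor_le_of_le
        (mul_le_of_le_one_left (by positivity) ((div_le_one hS).2 hp1.2))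
      simp only [Function.comp, gridPoint, hq, min_eq_left h3]
    exact (hp2 p.1 hp1).tendsto.comp (tendsto_nhdsWithin_iff.2
      ⟨hlim, Eventually.of_forall fun k => hgq k p.1⟩)

/-- A process with continuous paths and uniformly bounded second moments is square integrable
on the product space. -/
lemma memLp_uncurry_of_eLpNorm_le [IsProbabilityMeasure P] [SecondCountableTopology E]
    (hS : 0 < S) (hm : ∀ t ∈ Set.Icc 0 S, StronglyMeasurable (Y t))
    (hc : ∀ᵐ ω ∂P, ContinuousOn (fun t => Y t ω) (Set.Icc 0 S)) {C : ℝ≥0∞} (hC : C ≠ ∞)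
    (hle : ∀ t ∈ Set.Icc 0 S, eLpNorm (Y t) 2 P ≤ C) :
    MemLp (fun p : ℝ × Ω => Y p.1 p.2) 2 ((volume.restrict (Set.Icc 0 S)).prod P) := by
  have hYm := aestronglyMeasurable_uncurry_of_continuousOn hS hm hc
  refine ⟨hYm, ?_⟩
  rw [eLpNorm_lt_top_iff_lintegral_rpow_enorm_lt_top (by norm_num) (by norm_num),
    lintegral_prod _ (hYm.enorm.pow_const _)]
  have hle' : ∀ t ∈ Set.Icc 0 S, ∫⁻ ω, ‖Y t ω‖ₑ ^ (2 : ℝ≥0∞).toReal ∂P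
      ≤ C ^ (2 : ℝ≥0∞).toReal := fun t ht => by
    have := hle t ht
    rw [eLpNorm_eq_lintegral_rpow_enorm_toReal (by norm_num) (by norm_num), one_div,
      ENNReal.rpow_inv_le_iff (by norm_num)] at this
    exact this
  refine (setLIntegral_mono measurable_const hle').trans_lt ?_
  rw [setLIntegral_const]
  refine ENNReal.mul_lt_top (ENNReal.rpow_lt_top_of_nonneg (by norm_num) hC) ?_
  simp

end LinearSDE

end DelayedSDE

namespace DelayedSDE

/-! ### The closed loop -/

section ClosedLoop

variable {Ω : Type*} {mΩ : MeasurableSpace Ω} {P : Measure Ω} {ℱ : Filtration ℝ≥0 mΩ}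
  {W : ℝ≥0 → Ω → ℝ}

lemma SolvesSDE.congr_drift {E : Type*} [NormedAddCommGroup E] [NormedSpace ℝ E] {S : ℝ}
    {b b' : ℝ → Ω → E} {σ : ℝ → E} {Y : ℝ → Ω → E} (hY : SolvesSDE P ℱ W S b σ Y)
    (h : ∀ t ∈ Set.Icc 0 S, ∀ ω, b t ω = b' t ω) : SolvesSDE P ℱ W S b' σ Y := by
  refine ⟨hY.adapted, hY.continuous, hY.initial, ?_, fun t ht => ?_⟩
  · filter_upwards [hY.integrable] with ω hω
    exact hω.congr_fun (fun s hs => h s hs ω) measurableSet_Icc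
  · refine (hY.equation t ht).congr (Eventually.of_forall fun ω => ?_)
    simp only
    congr 1
    refine intervalIntegral.integral_congr fun s hs => h s ?_ ω
    rw [Set.uIcc_of_le t.coe_nonneg] at hs
    exact ⟨hs.1, hs.2.trans ht⟩

variable {n m : ℕ} {A : ℝ → Matrix (Fin n) (Fin n) ℝ} {B : ℝ → Matrix (Fin n) (Fin m) ℝ}
  {σ : ℝ → EuclideanSpace ℝ (Fin n)} {T h : ℝ} {K : ℝ → Matrix (Fin m) (Fin n) ℝ} {N : ℕ}
  {Y : ℝ → Ω → EuclideanSpace ℝ (Fin n)}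

/-- The feedback replaces the drift by `-N Y`. -/
lemma closedLoop_drift (hK : ∀ t ∈ Set.Icc 0 (T - h), Bbar A B T h t * K t = 1) {t : ℝ}
    (ht : t ∈ Set.Icc 0 (T - h)) (ω : Ω) :
    Matrix.toEuclideanLin (A t) (Y t ω) +
      Matrix.toEuclideanLin (Bbar A B T h t) (feedback A K N Y t ω) = -(N : ℝ) • Y t ω := by
  have e : Matrix.toEuclideanLin (Bbar A B T h t) (feedback A K N Y t ω)
      = -Matrix.toEuclideanLin (A t + (N : ℝ) • (1 : Matrix (Fin n) (Fin n) ℝ)) (Y t ω) := by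
    rw [feedback, map_neg, neg_inj]
    apply WithLp.ofLp_injective
    simp only [Matrix.ofLp_toLpLin, Matrix.toLin'_apply, Matrix.mulVec_mulVec]
    rw [← Matrix.mul_assoc, hK t ht, Matrix.one_mul]
  rw [e]
  apply WithLp.ofLp_injective
  simp

/-- The drifts agree at every `t` in `[0,T-h]` and every `ω`, so the same processes solve both
equations; existence, uniqueness and bounds all transfer. -/
lemma solvesArtstein_iff (hK : ∀ t ∈ Set.Icc 0 (T - h), Bbar A B T h t * K t = 1) :
    SolvesArtstein P ℱ W A B σ T h (feedback A K N Y) Y ↔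
      SolvesSDE P ℱ W (T - h) (fun t ω => -(N : ℝ) • Y t ω) σ Y :=
  ⟨fun hY => SolvesSDE.congr_drift hY fun _ ht ω => closedLoop_drift hK ht ω,
    fun hY => SolvesSDE.congr_drift hY fun _ ht ω => (closedLoop_drift hK ht ω).symm⟩

/-- The feedback is a square integrable adapted control if the gain is essentially bounded. -/
lemma isSquareIntegrableAdapted_feedback [IsProbabilityMeasure P] {S : ℝ} (hS : 0 < S)
    (hA : MemLp A ∞ (volume.restrict (Set.Icc 0 S)))
    (hK : MemLp K ∞ (volume.restrict (Set.Icc 0 S)))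
    (hYa : ∀ t : ℝ≥0, (t : ℝ) ≤ S → StronglyMeasurable[ℱ t] (Y t))
    (hYc : ∀ᵐ ω ∂P, ContinuousOn (fun t => Y t ω) (Set.Icc 0 S)) {C : ℝ≥0∞} (hC : C ≠ ∞)
    (hle : ∀ t ∈ Set.Icc 0 S, eLpNorm (Y t) 2 P ≤ C) :
    IsSquareIntegrableAdapted P ℱ S (feedback A K N Y) := by
  have hcont : Continuous fun p : Matrix (Fin m) (Fin n) ℝ × EuclideanSpace ℝ (Fin n) =>
      -Matrix.toEuclideanLin p.1 p.2 := by
    refine Continuous.neg ?_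
    simp only [Matrix.toLpLin_apply]
    refine (PiLp.continuous_toLp 2 _).comp ?_
    exact continuous_fst.matrix_mulVec ((PiLp.continuous_ofLp 2 _).comp continuous_snd)
  refine ⟨fun t ht => ?_, ?_⟩
  · exact (hcont.comp (Continuous.prodMk_right
      (K t * (A t + (N : ℝ) • (1 : Matrix (Fin n) (Fin n) ℝ))))).comp_stronglyMeasurable (hYa t ht)
  · have hY2 := memLp_uncurry_of_eLpNorm_le hS
      (fun t ht => (hYa ⟨t, ht.1⟩ ht.2).mono (ℱ.le _)) hYc hC hle
    have hGm : AEStronglyMeasurable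
        (fun t => K t * (A t + (N : ℝ) • (1 : Matrix (Fin n) (Fin n) ℝ)))
        (volume.restrict (Set.Icc 0 S)) :=
      aestronglyMeasurable_matrix_mul hK.1 (hA.1.add aestronglyMeasurable_const)
    have hUm : AEStronglyMeasurable (fun p : ℝ × Ω => feedback A K N Y p.1 p.2)
        ((volume.restrict (Set.Icc 0 S)).prod P) := by
      have hG : AEStronglyMeasurable
          (fun p : ℝ × Ω => K p.1 * (A p.1 + (N : ℝ) • (1 : Matrix (Fin n) (Fin n) ℝ)))
          ((volume.restrict (Set.Icc 0 S)).prod P) := hGm.comp_fst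
      have h := hcont.comp_aestronglyMeasurable (hG.prodMk hY2.1)
      exact h
    set a := (eLpNorm A ∞ (volume.restrict (Set.Icc 0 S))).toReal
    set κ := (eLpNorm K ∞ (volume.restrict (Set.Icc 0 S))).toReal
    have hκ : 0 ≤ κ := ENNReal.toReal_nonneg
    -- Pointwise domination `‖U‖ ≤ ‖K‖∞ (‖A‖∞ + ‖N I‖) ‖Y‖`.
    refine hY2.of_le_mul (c := κ * (a + ‖(N : ℝ) • (1 : Matrix (Fin n) (Fin n) ℝ)‖)) hUm ?_
    filter_upwards [Measure.quasiMeasurePreserving_fst.ae (ae_norm_le_of_memLp_top hA),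
      Measure.quasiMeasurePreserving_fst.ae (ae_norm_le_of_memLp_top hK)] with p h1 h2
    rw [feedback, norm_neg]
    refine (norm_toEuclideanLin_le _ _).trans (mul_le_mul_of_nonneg_right ?_ (norm_nonneg _))
    refine (Matrix.l2_opNorm_mul _ _).trans (mul_le_mul h2 ?_ (norm_nonneg _) hκ)
    exact (norm_add_le _ _).trans (add_le_add_left h1 _)

end ClosedLoop

end DelayedSDE

/-! ### The main theorem -/

theorem mainTheorem8 {Ω : Type*} {mΩ : MeasurableSpace Ω} (P : Measure Ω) [IsProbabilityMeasure P]
    (ℱ : Filtration ℝ≥0 mΩ) (W : ℝ≥0 → Ω → ℝ) (hW : IsBrownianReal W P)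
    (hWad : StronglyAdapted ℱ W) (n m : ℕ) (T h : ℝ) (hh : 0 < h) (hhT : h < T)
    (A : ℝ → Matrix (Fin n) (Fin n) ℝ) (B : ℝ → Matrix (Fin n) (Fin m) ℝ)
    (σ : ℝ → EuclideanSpace ℝ (Fin n))
    (hA : MemLp A ∞ (volume.restrict (Set.Icc 0 T)))
    (hB : MemLp B ∞ (volume.restrict (Set.Icc 0 T)))
    (hσ : MemLp σ ∞ (volume.restrict (Set.Icc 0 T)))
    (hrank : ∀ t ∈ Set.Icc h T, (B t).rank = n) :
    -- a measurable right inverse of `B̄` exists, bounded if `B` has uniformly full rank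
    (∃ K : ℝ → Matrix (Fin m) (Fin n) ℝ,
      AEStronglyMeasurable K (volume.restrict (Set.Icc 0 (T - h))) ∧
      (∀ t ∈ Set.Icc 0 (T - h), Bbar A B T h t * K t = 1) ∧
      ((∃ c : ℝ, 0 < c ∧ ∀ᵐ t ∂(volume.restrict (Set.Icc h T)),
          (B t * (B t)ᵀ - c • (1 : Matrix (Fin n) (Fin n) ℝ)).PosSemidef) →
        MemLp K ∞ (volume.restrict (Set.Icc 0 (T - h))))) ∧
    -- every such right inverse gives a well-posed closed loop with the stated bound
    (∀ K : ℝ → Matrix (Fin m) (Fin n) ℝ,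
      AEStronglyMeasurable K (volume.restrict (Set.Icc 0 (T - h))) →
      (∀ t ∈ Set.Icc 0 (T - h), Bbar A B T h t * K t = 1) →
      ∀ N : ℕ, 1 ≤ N →
        (∃ Y, SolvesArtstein P ℱ W A B σ T h (feedback A K N Y) Y) ∧
        (∀ Y Y', SolvesArtstein P ℱ W A B σ T h (feedback A K N Y) Y →
          SolvesArtstein P ℱ W A B σ T h (feedback A K N Y') Y' →
          ∀ᵐ ω ∂P, ∀ t ∈ Set.Icc 0 (T - h), Y t ω = Y' t ω) ∧
        (∀ Y, SolvesArtstein P ℱ W A B σ T h (feedback A K N Y) Y →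
          SolvesSDE P ℱ W (T - h) (fun t ω => -(N : ℝ) • Y t ω) σ Y ∧
          (∀ S : Matrix (Fin n) (Fin n) ℝ, S.PosSemidef → ∀ t ∈ Set.Icc 0 (T - h),
            Integrable (fun ω => (Y t ω).ofLp ⬝ᵥ (S *ᵥ (Y t ω).ofLp)) P ∧
            ∫ ω, (Y t ω).ofLp ⬝ᵥ (S *ᵥ (Y t ω).ofLp) ∂P ≤
              ‖S‖ * (eLpNorm σ ∞ (volume.restrict (Set.Icc 0 T))).toReal ^ 2 / (2 * N)) ∧
          (MemLp K ∞ (volume.restrict (Set.Icc 0 (T - h))) →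
            IsSquareIntegrableAdapted P ℱ (T - h) (feedback A K N Y)))) := by
  have hS : 0 < T - h := by linarith
  have hsub : Set.Ioc 0 (T - h) ⊆ Set.Icc 0 T := fun r hr => ⟨hr.1.le, by linarith [hr.2]⟩
  have hσ2 : MemLp σ 2 (volume.restrict (Set.Ioc 0 (T - h))) :=
    (hσ.mono_measure (Measure.restrict_mono hsub le_rfl)).mono_exponent le_top
  have hA' : MemLp A ∞ (volume.restrict (Set.Icc 0 (T - h))) :=
    hA.mono_measure (Measure.restrict_mono (Set.Icc_subset_Icc_right (by linarith)) le_rfl)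
  refine ⟨exists_right_inverse_Bbar hh hhT hA hB hrank, fun K _ hK N hN => ?_⟩
  have hN0 : (0 : ℝ) < N := by exact_mod_cast hN
  set s := (eLpNorm σ ∞ (volume.restrict (Set.Icc 0 T))).toReal
  have hs : ∀ᵐ r ∂(volume.restrict (Set.Ioc 0 (T - h))), ‖σ r‖ ≤ s :=
    ae_restrict_of_ae_restrict_of_subset hsub (ae_norm_le_of_memLp_top hσ)
  simp only [solvesArtstein_iff hK]
  refine ⟨exists_solvesSDE hW hWad hS.le hN0.le hσ2, fun Y Y' hY hY' =>
    hY.indistinguishable hW.toIsPreBrownianReal hS.le hσ2 hY', fun Y hY => ⟨hY, ?_, ?_⟩⟩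
  · intro M hM t ht
    have hle := hY.eLpNorm_le hW.toIsPreBrownianReal hN0 hσ2 hs ht
    have hYm : AEStronglyMeasurable (Y t) P :=
      ((hY.adapted ⟨t, ht.1⟩ ht.2).mono (ℱ.le _)).aestronglyMeasurable
    have hY2 : MemLp (Y t) 2 P := ⟨hYm, hle.trans_lt ENNReal.ofReal_lt_top⟩
    have hsq := integrable_norm_sq hY2
    have hbound : ∀ ω, (Y t ω).ofLp ⬝ᵥ (M *ᵥ (Y t ω).ofLp) ≤ ‖M‖ * ‖Y t ω‖ ^ 2 := fun ω =>
      dotProduct_mulVec_le M (Y t ω)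
    have hnonneg : ∀ ω, 0 ≤ (Y t ω).ofLp ⬝ᵥ (M *ᵥ (Y t ω).ofLp) := fun ω => by
      simpa using hM.dotProduct_mulVec_nonneg (Y t ω).ofLp
    have hcont : Continuous fun y : EuclideanSpace ℝ (Fin n) => y.ofLp ⬝ᵥ (M *ᵥ y.ofLp) := by
      have h0 := PiLp.continuous_ofLp 2 (fun _ : Fin n => ℝ)
      exact h0.dotProduct (continuous_const.matrix_mulVec h0)
    have hint : Integrable (fun ω => (Y t ω).ofLp ⬝ᵥ (M *ᵥ (Y t ω).ofLp)) P := by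
      refine (hsq.const_mul ‖M‖).mono' (hcont.comp_aestronglyMeasurable hYm)
        (Eventually.of_forall fun ω => ?_)
      rw [Real.norm_of_nonneg (hnonneg ω)]
      exact hbound ω
    refine ⟨hint, (integral_mono hint (hsq.const_mul ‖M‖) hbound).trans ?_⟩
    rw [integral_const_mul, mul_div_assoc]
    refine mul_le_mul_of_nonneg_left ?_ (norm_nonneg M)
    -- Both sides are now square roots, so the norm bound becomes the second moment bound `s² /
    -- (2N)`.
    rw [eLpNorm_two_eq hY2] at hle
    exact (Real.sqrt_le_sqrt_iff (by positivity)).1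
      ((ENNReal.ofReal_le_ofReal_iff (Real.sqrt_nonneg _)).1 hle)
  · intro hKb
    exact isSquareIntegrableAdapted_feedback hS hA' hKb hY.adapted hY.continuous
      ENNReal.ofReal_ne_top fun t ht => hY.eLpNorm_le hW.toIsPreBrownianReal hN0 hσ2 hs ht
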